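/- Let $k$ be a field and $Q=k[x_1,\dots,x_n]$ with its $\mathbb N^n$-grading. Let $E$ and $G$ be finite free multigraded $Q$-modules with homogeneous bases $\epsilon_1,\dots,\epsilon_e$ and $\gamma_1,\dots,\gamma_g$, with multidegrees $|\epsilon_j|,|\gamma_i|\in\mathbb N^n$, and let $\phi\colon E\to G$ be a multigraded (multidegree-preserving) morphism of rank $r$. In these bases $\phi$ has a matrix with entries $c_{ij}x^{a_{ij}}$, where $c_{ij}\in k$ and $c_{ij}=0$ for zero entries; $C=(c_{ij})$ is the coefficient matrix. Let $U=k^e$ and $W=k^g$, with the standard basis of $U$ again written $\epsilon_1,\dots,\epsilon_e$, let $s\colon U\to W$ be the linear map with matrix $C$, let $V=\operatorname{im}s$, and let $D_pV^*=(S_pV)^*$ denote the divided powers of $V^*$. For $I\subseteq\{1,\dots,e\}$ let $|\epsilon_I|\in\mathbb N^n$ be the componentwise maximum of the $|\epsilon_i|$, $i\in I$; for $l\in I$ let $\operatorname{sgn}(l,I\setminus l)=(-1)^{\#\{m\in I\,:\,m<l\}}$. The Taylor complex $T_\bullet(\phi)$ has $T_0=G$, $T_1=E$, and, for $i\ge 2$,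 $$T_i=\bigoplus_{|I|=r+i-1}Q\otimes_k D_{i-2}V^*\otimes_k k\,\epsilon_I\otimes_k\wedge^rV^* ,$$ with differentials $\phi_i\colon T_i\to T_{i-1}$ given by $\phi_1=\phi$, $$\phi_2(y\otimes 1\otimes\epsilon_I\otimes\omega)=\sum_{l\in I}\operatorname{sgn}(l,I\setminus l)\,x^{|\epsilon_I|-|\epsilon_l|}\,y\,\langle \wedge^r s(\epsilon_{I\setminus l}),\omega\rangle\,\epsilon_l ,$$ and, for $i\ge 3$, $$\phi_i(y\otimes w\otimes\epsilon_I\otimes\omega)=\sum_{l\in I}\operatorname{sgn}(l,I\setminus l)\,x^{|\epsilon_I|-|\epsilon_{I\setminus l}|}\,y\otimes (s(\epsilon_l)\lrcorner w)\otimes\epsilon_{I\setminus l}\otimes\omega ,$$ where $\epsilon_{\{i_1<\dots<i_q\}}=\epsilon_{i_1}\wedge\dots\wedge\epsilon_{i_q}$, $\langle\cdot,\cdot\rangle$ is the determinant pairing of $\wedge^rV$ with $\wedge^rV^*$, and $v\lrcorner\colon D_pV^*\to D_{p-1}V^*$ is the transpose of multiplication by $v\in V$. If $\phi$ has uniform rank,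 that is, if every $g\times r$ submatrix of $C$ has rank $r=\operatorname{rank}\phi$, then $T_\bullet(\phi)$ is a complex of finite free $Q$-modules that is exact in all positive homological degrees. It is therefore, with the canonical projection $G\to\operatorname{coker}\phi$, a free resolution of $\operatorname{coker}\phi$. -/

import Mathlib

open scoped TensorProduct

universe u

noncomputable section

namespace BRT

/-- A homogeneous basis of a finite free multigraded module `E` of rank `e` over
`Q = k[x₁, …, xₙ]`: a `Q`-basis of `E` together with the multidegrees (in `ℕⁿ`) of its elements.
These data determine the multigrading of `E`. -/
structure HomogeneousBasis (k : Type u) [Field k] (n e : ℕ) (E : Type u) [AddCommGroup E]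
    [Module (MvPolynomial (Fin n) k) E] where
  /-- the underlying basis -/
  basis : Module.Basis (Fin e) (MvPolynomial (Fin n) k) E
  /-- the multidegrees of the basis elements -/
  deg : Fin e → (Fin n →₀ ℕ)

/-- `x` lies in the component of multidegree `a` of `E`: every monomial `x^ν` that occurs in the
coordinate of `x` at the `j`th basis element satisfies `ν + deg j = a`. -/
def HomogeneousBasis.IsHomogeneous {k : Type u} [Field k] {n e : ℕ} {E : Type u} [AddCommGroup E]
    [Module (MvPolynomial (Fin n) k) E] (bE : HomogeneousBasis k n e E)
    (a : Fin n →₀ ℕ) (x : E) : Prop :=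
  ∀ j : Fin e, ∀ ν ∈ (bE.basis.repr x j).support, ν + bE.deg j = a

section LinearAlgebra

variable (k : Type u) [Field k] (V : Type u) [AddCommGroup V] [Module k V]

/-- The symmetric power `S_p V`: the `p`th power, inside the symmetric algebra of `V`, of the
subspace `V` of generators. -/
abbrev SymPow (p : ℕ) : Submodule k (SymmetricAlgebra k V) :=
  (LinearMap.range (SymmetricAlgebra.ι k V)) ^ p

/-- The divided power `D_p V* = (S_p V)*`. -/
def DivPow (p : ℕ) : Type u := Module.Dual k (SymPow k V p)

instance instAddCommGroupDivPow (p : ℕ) : AddCommGroup (DivPow k V p) :=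
  inferInstanceAs (AddCommGroup (Module.Dual k (SymPow k V p)))

instance instModuleDivPow (p : ℕ) : Module k (DivPow k V p) :=
  inferInstanceAs (Module k (Module.Dual k (SymPow k V p)))

/-- The one-dimensional (if `r = dim V`) space `∧^r V*`. -/
abbrev TopDual (r : ℕ) : Type u := ⋀[k]^r (Module.Dual k V)

variable {V}

/-- Multiplication by `v`, as a map `S_p V → S_{p+1} V`. -/
def symMul (v : V) (p : ℕ) : SymPow k V p →ₗ[k] SymPow k V (p + 1) :=
  (LinearMap.mulLeft k (SymmetricAlgebra.ι k V v)).restrict fun x hx => by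
    rw [SymPow, pow_succ']
    exact Submodule.mul_mem_mul (LinearMap.mem_range_self _ v) hx

/-- Contraction with `v`, as a map `D_{p+1} V* → D_p V*`. It is the diagonal map
`D_{p+1} V* → D_p V* ⊗ V*` followed by evaluation of the factor `V*` at `v`; equivalently, the
transpose of multiplication by `v`. On basis elements it sends
`v^(b)` to `∑ⱼ vⱼ(v) v^(b_j)`, where `b_j` is `b` with its `j`th entry lowered by one. -/
def contract (v : V) (p : ℕ) : DivPow k V (p + 1) →ₗ[k] DivPow k V p :=
  (symMul k v p).dualMap

variable (V) in
/-- The canonical identification `D_0 V* = k` (evaluation at `1 ∈ S_0 V`). -/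
def divPowZero : DivPow k V 0 →ₗ[k] k :=
  LinearMap.applyₗ (⟨1, by rw [SymPow, pow_zero]; exact Submodule.one_le.mp le_rfl⟩ : SymPow k V 0)

/-- Pairing `∧^r V* → k` with the element `v₁ ∧ ⋯ ∧ v_r` of `∧^r V`. -/
def pairWith {r : ℕ} (v : Fin r → V) : TopDual k V r →ₗ[k] k :=
  LinearMap.applyₗ (exteriorPower.ιMulti k r v) ∘ₗ exteriorPower.pairingDual k V r

end LinearAlgebra

/-- The faces of cardinality `m` of the full simplex on `e` vertices. -/
abbrev Face (e m : ℕ) : Type := {I : Finset (Fin e) // I.card = m}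

/-- The face `J ∪ {l}`, for `l ∉ J`. -/
def Face.insert {e m : ℕ} (J : Face e m) (l : {l : Fin e // l ∉ J.1}) : Face e (m + 1) :=
  ⟨Insert.insert l.1 J.1, by rw [Finset.card_insert_of_notMem l.2, J.2]⟩

/-- `sgn(l, J)`, for `l ∉ J`: the sign with which `e_l ∧ e_J` equals `e_{J ∪ {l}}`. -/
def sgn {e : ℕ} (l : Fin e) (J : Finset (Fin e)) : ℤ := (-1) ^ (J.filter (· < l)).card

section Taylor

variable {k : Type u} [Field k] {n e g : ℕ} {E G : Type u}
  [AddCommGroup E] [Module (MvPolynomial (Fin n) k) E]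
  [AddCommGroup G] [Module (MvPolynomial (Fin n) k) G]
  (bE : HomogeneousBasis k n e E) (bG : HomogeneousBasis k n g G)
  (φ : E →ₗ[MvPolynomial (Fin n) k] G)

/-- `φ` is a multigraded morphism: it preserves multidegrees. -/
def IsMultigraded : Prop :=
  ∀ (a : Fin n →₀ ℕ) (x : E), bE.IsHomogeneous a x → bG.IsHomogeneous a (φ x)

/-- The rank of `φ`. -/
def rk : ℕ := Module.finrank (MvPolynomial (Fin n) k) (LinearMap.range φ)

/-- The coefficient matrix `C = (c_{ij})` of `φ`. If `φ` is multigraded, its matrix has entries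
of the form `f_{ij} = c_{ij} x^{a_{ij}}`, so that `c_{ij}` is the value of `f_{ij}` at
`(1, …, 1)`. -/
def coeffMatrix : Matrix (Fin g) (Fin e) k :=
  (LinearMap.toMatrix bE.basis bG.basis φ).map (MvPolynomial.eval fun _ => (1 : k))

/-- The map `s : U → W` of vector spaces with matrix `C`, where `U = kᵉ` and `W = kᵍ`. -/
def coeffMap : (Fin e → k) →ₗ[k] (Fin g → k) := (coeffMatrix bE bG φ).mulVecLin

/-- The image `V` of `s`. -/
abbrev imS : Submodule k (Fin g → k) := LinearMap.range (coeffMap bE bG φ)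

/-- The element `s(e_l)` of `V`. -/
def sBasis (l : Fin e) : imS bE bG φ := (coeffMap bE bG φ).rangeRestrict (Pi.single l 1)

/-- `φ` has uniform rank: all `g × r` submatrices of the coefficient matrix have rank `r`, where
`r = rank φ`. -/
def HasUniformRank : Prop :=
  ∀ c : Fin (rk φ) ↪o Fin e, ((coeffMatrix bE bG φ).submatrix id c).rank = rk φ

/-- The multidegree `|e_I|` of a face: the join of the multidegrees of its vertices. -/
def faceDeg (I : Finset (Fin e)) : Fin n →₀ ℕ := I.sup bE.deg

/-- The module `T_{p+2}` of the Taylor complex, the direct sum of the modules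
`Q ⊗ D_p V* ⊗ e_I ⊗ ∧^r V*` over all `I` with `|I| = r + p + 1`. -/
abbrev HigherTaylor (p : ℕ) : Type u :=
  Face e (rk φ + p + 1) → MvPolynomial (Fin n) k ⊗[k]
    (DivPow k (imS bE bG φ) p ⊗[k] TopDual k (imS bE bG φ) (rk φ))

/-- The component `φ_2^{I,l}` (without the factor `e_l`) of the second differential:
`y ⊗ w ⊗ e_I ⊗ ω ↦ sgn(l, I \ l) x^{|e_I| - |e_l|} y w ⟨s(e_{i₁}) ∧ ⋯ ∧ s(e_{i_r}), ω⟩`,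
where `I \ l = {i₁ < ⋯ < i_r}`. -/
def taylorTwoComponent (I : Face e (rk φ + 0 + 1)) (l : {l : Fin e // l ∈ I.1}) :
    (MvPolynomial (Fin n) k ⊗[k]
      (DivPow k (imS bE bG φ) 0 ⊗[k] TopDual k (imS bE bG φ) (rk φ)))
      →ₗ[MvPolynomial (Fin n) k] MvPolynomial (Fin n) k :=
  (MvPolynomial.monomial (faceDeg bE I.1 - bE.deg l.1) (sgn l.1 (I.1.erase l.1) : k)) •
    ((TensorProduct.AlgebraTensorModule.rid k (MvPolynomial (Fin n) k)
        (MvPolynomial (Fin n) k)).toLinearMap ∘ₗ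
      LinearMap.baseChange (MvPolynomial (Fin n) k)
        (LinearMap.mul' k k ∘ₗ TensorProduct.map (divPowZero k (imS bE bG φ))
          (pairWith k fun t => sBasis bE bG φ
            ((I.1.erase l.1).orderEmbOfFin
              (by rw [Finset.card_erase_of_mem l.2, I.2]; rfl) t))))

/-- The second differential `φ_2 : T_2 → T_1 = E` of the Taylor complex. -/
def taylorTwo : HigherTaylor bE bG φ 0 →ₗ[MvPolynomial (Fin n) k] E :=
  ∑ I : Face e (rk φ + 0 + 1), ∑ l : {l : Fin e // l ∈ I.1},
    (taylorTwoComponent bE bG φ I l ∘ₗ LinearMap.proj I).smulRight (bE.basis l.1)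

/-- The differential `φ_{p+3} : T_{p+3} → T_{p+2}` of the Taylor complex. Its component from the
face `I = J ∪ {l}` to the face `J` sends `y ⊗ w ⊗ e_I ⊗ ω` to
`sgn(l, J) x^{|e_I| - |e_J|} y ⊗ (contraction of w with s(e_l)) ⊗ e_J ⊗ ω`. -/
def taylorHigher (p : ℕ) :
    HigherTaylor bE bG φ (p + 1) →ₗ[MvPolynomial (Fin n) k] HigherTaylor bE bG φ p :=
  LinearMap.pi fun J => ∑ l : {l : Fin e // l ∉ J.1},
    (MvPolynomial.monomial (faceDeg bE (J.insert l).1 - faceDeg bE J.1) (sgn l.1 J.1 : k)) •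
      (LinearMap.baseChange (MvPolynomial (Fin n) k)
          (LinearMap.rTensor (TopDual k (imS bE bG φ) (rk φ))
            (contract k (sBasis bE bG φ l.1) p)) ∘ₗ
        LinearMap.proj (J.insert l))

/-- The modules `T_i` of the Taylor complex `T_•(φ)`. -/
def Taylor : ℕ → Type u
  | 0 => G
  | 1 => E
  | p + 2 => HigherTaylor bE bG φ p

instance instAddCommGroupTaylor : ∀ i, AddCommGroup (Taylor bE bG φ i)
  | 0 => inferInstanceAs (AddCommGroup G)
  | 1 => inferInstanceAs (AddCommGroup E)
  | p + 2 => inferInstanceAs (AddCommGroup (HigherTaylor bE bG φ p))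

instance instModuleTaylor : ∀ i, Module (MvPolynomial (Fin n) k) (Taylor bE bG φ i)
  | 0 => inferInstanceAs (Module (MvPolynomial (Fin n) k) G)
  | 1 => inferInstanceAs (Module (MvPolynomial (Fin n) k) E)
  | p + 2 => inferInstanceAs (Module (MvPolynomial (Fin n) k) (HigherTaylor bE bG φ p))

/-- The differential `φ_{i+1} : T_{i+1} → T_i` of the Taylor complex `T_•(φ)`. -/
def taylorD : ∀ i, Taylor bE bG φ (i + 1) →ₗ[MvPolynomial (Fin n) k] Taylor bE bG φ i
  | 0 => φ
  | 1 => taylorTwo bE bG φ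
  | p + 2 => taylorHigher bE bG φ p

/-- The augmentation `T_0 = G → coker φ`. -/
def taylorAug : Taylor bE bG φ 0 →ₗ[MvPolynomial (Fin n) k] G ⧸ LinearMap.range φ :=
  (LinearMap.range φ).mkQ

end Taylor

end BRT

end

/-! All maps are multigraded, so exactness may be tested in one multidegree `a` at a time
(`exact_of_strand`). Let `S` be the set of vertices `l` with `|ε_l| ≤ a`. Because `|ε_I|` is a join,
`|ε_I| ≤ a` holds exactly when `I ⊆ S`. In positive homological degrees the strand is therefore the
complex of vector spaces `⋯ → D_1 V* ⊗ ∧^{r+2} k^S → ∧^{r+1} k^S → k^S`, twisted by the line `∧^r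
V*` from homological degree 2 on, with every monomial replaced by 1.

Uniform rank means that any `r` of the vectors `s(ε_l)` form a basis of `V`; that `dim V = r` is
`finrank_imS`. Exactness of the strands is proved by induction on `S`, adjoining a vertex `l`
smaller than all the others. The part of a chain on faces through `l`, its link, is a chain on `S`
with one vertex less per face. If the link bounds on `S`, the cone from `l` over a bounding chain
changes the given chain by a boundary into one that avoids `l` (`exists_sub_koszulD_suppOn`), and
the induction hypothesis applies.

The induction starts from sets of at most `r` vertices, whose vectors are part of a basis of `V`.
There the input is division by a basis vector in the symmetric algebra: its transpose lifts elements
of divided powers along a contraction without disturbing the other contractions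
(`exists_contract_eq`).

At the lower end, `φ_2` records Cramer's relation among `r + 1` vectors of an `r`-dimensional space.
The expansion `sum_pairWith_smul_eq_zero` gives both `φ φ_2 = 0` and `φ_2 φ_3 = 0`. Links of chains
at `∧^{r+1} k^S` are handled by augmenting `∧^r k^S` to `∧^r V`, and every relation among the
`s(ε_l)` is a combination of Cramer relations (`exists_splice_eq`). -/

namespace BRT

/-! ### Signs of the simplex. -/

section Sign

variable {e : ℕ}

lemma sgn_mul_self (l : Fin e) (J : Finset (Fin e)) : sgn l J * sgn l J = 1 := by
  simp [sgn, ← mul_pow]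

lemma sgn_insert_of_lt {l m : Fin e} {J : Finset (Fin e)} (hm : m ∉ J) (h : m < l) :
    sgn l (insert m J) = -sgn l J := by
  rw [sgn, Finset.filter_insert, if_pos h, Finset.card_insert_of_notMem (by simp [hm]), pow_succ,
    sgn, mul_neg_one]

lemma sgn_insert_of_gt {l m : Fin e} {J : Finset (Fin e)} (h : l < m) :
    sgn l (insert m J) = sgn l J := by
  rw [sgn, Finset.filter_insert, if_neg h.le.not_gt, sgn]

/-- This is `ε_l ∧ ε_m = -ε_m ∧ ε_l`, the source of all cancellations below. -/
lemma sgn_mul_sgn_insert {l m : Fin e} {J : Finset (Fin e)} (hl : l ∉ J) (hm : m ∉ J)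
    (h : l ≠ m) : sgn l J * sgn m (insert l J) = -(sgn m J * sgn l (insert m J)) := by
  rcases lt_or_gt_of_ne h with h | h
  · rw [sgn_insert_of_lt hl h, sgn_insert_of_gt h]; ring
  · rw [sgn_insert_of_gt h, sgn_insert_of_lt hm h]; ring

lemma sgn_of_forall_lt {l : Fin e} {J : Finset (Fin e)} (h : ∀ x ∈ J, l < x) : sgn l J = 1 := by
  rw [sgn, Finset.filter_false_of_mem fun x hx => (h x hx).le.not_gt]; simp

end Sign

/-! ### Koszul-type differentials and induction on the vertex set. -/

section Koszul

variable {k : Type*} [Field k] {e : ℕ} {A B C : Type*} [AddCommGroup A] [Module k A]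
  [AddCommGroup B] [Module k B] [AddCommGroup C] [Module k C]

/-- The Koszul-type differential on families indexed by subsets of `Fin e`, for a family `a` of
linear maps. -/
def koszulD (a : Fin e → A →ₗ[k] B) : (Finset (Fin e) → A) →ₗ[k] (Finset (Fin e) → B) :=
  LinearMap.pi fun J => ∑ l ∈ Jᶜ, sgn l J • (a l ∘ₗ LinearMap.proj (insert l J))

lemma koszulD_apply (a : Fin e → A →ₗ[k] B) (f : Finset (Fin e) → A) (J : Finset (Fin e)) :
    koszulD a f J = ∑ l ∈ Jᶜ, sgn l J • a l (f (insert l J)) := by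
  simp [koszulD]

/-- The family `f` is supported on the subsets of `S` of cardinality `q`. -/
def SuppOn (S : Finset (Fin e)) (q : ℕ) (f : Finset (Fin e) → A) : Prop :=
  ∀ J, f J ≠ 0 → J ⊆ S ∧ J.card = q

lemma SuppOn.zero (S : Finset (Fin e)) (q : ℕ) : SuppOn S q (0 : Finset (Fin e) → A) :=
  fun _ h => absurd rfl h

lemma SuppOn.add {S : Finset (Fin e)} {q : ℕ} {f g : Finset (Fin e) → A} (hf : SuppOn S q f)
    (hg : SuppOn S q g) : SuppOn S q (f + g) := by
  intro J hJ
  by_cases h : f J = 0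
  · exact hg J fun h' => hJ (by simp [h, h'])
  · exact hf J h

lemma SuppOn.sub {S : Finset (Fin e)} {q : ℕ} {f g : Finset (Fin e) → A} (hf : SuppOn S q f)
    (hg : SuppOn S q g) : SuppOn S q (f - g) := by
  intro J hJ
  by_cases h : f J = 0
  · exact hg J fun h' => hJ (by simp [h, h'])
  · exact hf J h

lemma SuppOn.mono {S T : Finset (Fin e)} {q : ℕ} {f : Finset (Fin e) → A} (hf : SuppOn S q f)
    (h : S ⊆ T) : SuppOn T q f :=
  fun J hJ => ⟨(hf J hJ).1.trans h, (hf J hJ).2⟩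

lemma SuppOn.eq_zero_of_card_lt {S : Finset (Fin e)} {q : ℕ} {f : Finset (Fin e) → A}
    (hf : SuppOn S q f) (h : S.card < q) : f = 0 := by
  funext J
  by_contra hJ
  have := hf J hJ
  have := Finset.card_le_card this.1
  omega

lemma SuppOn.koszulD {S : Finset (Fin e)} {q : ℕ} {f : Finset (Fin e) → A}
    (hf : SuppOn S (q + 1) f) (a : Fin e → A →ₗ[k] B) : SuppOn S q (koszulD a f) := by
  intro J hJ
  rw [koszulD_apply] at hJ
  obtain ⟨l, hl, h⟩ := Finset.exists_ne_zero_of_sum_ne_zero hJ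
  have h0 : f (insert l J) ≠ 0 := fun h' => h (by simp [h'])
  have := hf _ h0
  rw [Finset.card_insert_of_notMem (by simpa using hl)] at this
  exact ⟨(Finset.subset_insert _ _).trans this.1, by omega⟩

lemma koszulD_koszulD (a : Fin e → A →ₗ[k] B) (b : Fin e → B →ₗ[k] C)
    (hab : ∀ l m w, b l (a m w) = b m (a l w)) (f : Finset (Fin e) → A) :
    koszulD b (koszulD a f) = 0 := by
  funext J
  simp only [koszulD_apply, map_sum, Finset.smul_sum, Pi.zero_apply, map_zsmul, smul_smul]
  rw [Finset.sum_sigma']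
  -- Deleting `l` then `m` cancels deleting `m` then `l`: the signs are opposite and the maps agree
  -- by `hab`.
  refine Finset.sum_involution (fun x _ => ⟨x.2, x.1⟩) ?_ ?_ ?_ ?_
  · rintro ⟨l, m⟩ h
    simp only [Finset.mem_sigma, Finset.mem_compl, Finset.mem_insert, not_or] at h
    dsimp only
    rw [hab, Finset.insert_comm m l, ← add_smul,
      sgn_mul_sgn_insert h.1 h.2.2 (fun h' => h.2.1 h'.symm)]
    simp
  · rintro ⟨l, m⟩ h _ h'
    simp only [Finset.mem_sigma, Finset.mem_compl, Finset.mem_insert, not_or] at h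
    simp only [Sigma.mk.injEq, heq_eq_eq] at h'
    exact h.2.1 h'.1
  · rintro ⟨l, m⟩ h
    simp only [Finset.mem_sigma, Finset.mem_compl, Finset.mem_insert, not_or] at h ⊢
    exact ⟨h.2.2, fun h' => h.2.1 h'.symm, h.1⟩
  · rintro ⟨l, m⟩ h
    rfl

/-- The component of `f` at the subsets containing `l`. -/
def link (l : Fin e) (f : Finset (Fin e) → A) : Finset (Fin e) → A :=
  fun J => if l ∈ J then 0 else f (insert l J)

lemma SuppOn.link {l : Fin e} {S : Finset (Fin e)} {q : ℕ} {f : Finset (Fin e) → A}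
    (hf : SuppOn (insert l S) (q + 1) f) : SuppOn S q (link l f) := by
  intro J hJ
  unfold BRT.link at hJ
  split_ifs at hJ with h
  · exact absurd rfl hJ
  have := hf _ hJ
  rw [Finset.card_insert_of_notMem h] at this
  refine ⟨fun x hx => ?_, by omega⟩
  have := this.1 (Finset.mem_insert_of_mem hx)
  rw [Finset.mem_insert] at this
  exact this.resolve_left fun h' => h (h' ▸ hx)

lemma SuppOn.link_zero {l : Fin e} {S : Finset (Fin e)} {f : Finset (Fin e) → A}
    (hf : SuppOn (insert l S) 0 f) : BRT.link l f = 0 := by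
  funext J
  unfold BRT.link
  split_ifs with h
  · rfl
  by_contra hJ
  have := hf _ hJ
  rw [Finset.card_insert_of_notMem h] at this
  omega

lemma SuppOn.of_link_eq_zero {l : Fin e} {S : Finset (Fin e)} {q : ℕ} {f : Finset (Fin e) → A}
    (hf : SuppOn (insert l S) q f) (h : BRT.link l f = 0) : SuppOn S q f := by
  intro J hJ
  have := hf J hJ
  refine ⟨fun x hx => ?_, this.2⟩
  refine (Finset.mem_insert.1 (this.1 hx)).resolve_left ?_
  rintro rfl
  have h1 := congrFun h (J.erase x)
  simp only [BRT.link, Finset.notMem_erase, if_false, Finset.insert_erase hx, Pi.zero_apply] at h1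
  exact hJ h1

/-- Exterior multiplication by a new first vertex `l`. -/
def cone (l : Fin e) (f : Finset (Fin e) → A) : Finset (Fin e) → A :=
  fun J => if l ∈ J then f (J.erase l) else 0

lemma SuppOn.cone {l : Fin e} {S : Finset (Fin e)} {q : ℕ} {f : Finset (Fin e) → A}
    (hf : SuppOn S q f) : SuppOn (insert l S) (q + 1) (cone l f) := by
  intro J hJ
  unfold BRT.cone at hJ
  split_ifs at hJ with h
  · have := hf _ hJ
    rw [← Finset.insert_erase h, Finset.card_insert_of_notMem (Finset.notMem_erase _ _)]
    exact ⟨Finset.insert_subset_insert _ this.1, by rw [this.2]⟩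
  · exact absurd rfl hJ

/-- Since `l` precedes every vertex of `S`, it adds one sign to the deletion of any other vertex.
Faces through `l` in the boundary never arise by deleting `l`. -/
lemma link_koszulD {l : Fin e} {S : Finset (Fin e)} (hl : ∀ x ∈ S, l < x) {q : ℕ}
    (a : Fin e → A →ₗ[k] B) {f : Finset (Fin e) → A} (hf : SuppOn (insert l S) q f) :
    link l (koszulD a f) = -koszulD a (link l f) := by
  funext J
  rw [Pi.neg_apply, koszulD_apply, link]
  split_ifs with h
  · rw [Finset.sum_eq_zero, neg_zero]
    intro m _
    simp [link, h]
  · rw [koszulD_apply, ← Finset.sum_neg_distrib]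
    symm
    have hsub : (insert l J)ᶜ ⊆ Jᶜ :=
      Finset.compl_subset_compl.2 (Finset.subset_insert _ _)
    rw [← Finset.sum_subset hsub]
    · refine Finset.sum_congr rfl fun m hm => ?_
      simp only [Finset.mem_compl, Finset.mem_insert, not_or] at hm
      have h2 : l ∉ insert m J := by
        simp only [Finset.mem_insert, not_or]; exact ⟨fun h => hm.1 h.symm, h⟩
      rw [link, if_neg h2, Finset.insert_comm]
      by_cases h0 : f (insert m (insert l J)) = 0
      · simp [h0]
      have := (hf _ h0).1 (Finset.mem_insert_self _ _)
      have hlt := hl m ((Finset.mem_insert.1 this).resolve_left hm.1)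
      rw [sgn_insert_of_lt h hlt, neg_smul]
    · intro m hm hm'
      simp only [Finset.mem_compl, Finset.mem_insert, not_or, not_and, not_not] at hm hm'
      have : m = l := by by_contra h; exact hm (hm' h)
      subst this
      simp [link]

lemma link_cone {l : Fin e} {S : Finset (Fin e)} (hl : l ∉ S) {q : ℕ}
    {f : Finset (Fin e) → A} (hf : SuppOn S q f) : link l (cone l f) = f := by
  funext J
  unfold link cone
  by_cases h : l ∈ J
  · rw [if_pos h]
    by_contra h0
    exact hl ((hf J fun h' => h0 h'.symm).1 h)
  · simp [h]

/-- If the link of `f` at the first vertex `l` is a boundary, then `f` is homologous to a chain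
that avoids `l`. -/
lemma exists_sub_koszulD_suppOn {l : Fin e} {S : Finset (Fin e)} (hl : ∀ x ∈ S, l < x) {q : ℕ}
    (a : Fin e → A →ₗ[k] B) {f : Finset (Fin e) → B} (hf : SuppOn (insert l S) q f)
    {w : Finset (Fin e) → A} (hw : SuppOn S q w) (h : koszulD a w = link l f) :
    ∃ g, SuppOn (insert l S) (q + 1) g ∧ SuppOn S q (f - koszulD a g) := by
  have hlS : l ∉ S := fun h => (hl l h).false
  have hc : SuppOn (insert l S) (q + 1) (cone l w) := hw.cone
  have hg : SuppOn (insert l S) (q + 1) (-cone l w) := by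
    simpa using (SuppOn.zero _ _).sub hc
  refine ⟨-cone l w, hg, (hf.sub (hg.koszulD a)).of_link_eq_zero ?_⟩
  have h1 : link l (f - koszulD a (-cone l w)) = link l f - link l (koszulD a (-cone l w)) := by
    funext J
    simp only [link, Pi.sub_apply]
    split_ifs <;> simp
  have h2 : link l (-cone l w) = -link l (cone l w) := by
    funext J
    simp only [link, Pi.neg_apply]
    split_ifs <;> simp
  rw [h1, link_koszulD hl a hg, h2, link_cone hlS hw, map_neg, neg_neg, h, sub_self]

/-- Exactness at the middle term `B` of the strand of Koszul type on the subsets of `S`. -/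
def ExactOn (a : Fin e → A →ₗ[k] B) (b : Fin e → B →ₗ[k] C) (S : Finset (Fin e)) (q : ℕ) : Prop :=
  ∀ f : Finset (Fin e) → B, SuppOn S q f → koszulD b f = 0 →
    ∃ g : Finset (Fin e) → A, SuppOn S (q + 1) g ∧ koszulD a g = f

section Triple

variable {a : Fin e → A →ₗ[k] B} {b : Fin e → B →ₗ[k] C}
  (hab : ∀ l m w, b l (a m w) = b m (a l w))
include hab

/-- The link of a cycle is a cycle on faces one vertex smaller, so exactness on `S` at size `q - 1`
makes it a boundary. At `q = 0` there is no link, hence no hypothesis. -/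
lemma ExactOn.exists_sub_suppOn {l : Fin e} {S : Finset (Fin e)}
    (hl : ∀ x ∈ S, l < x) {q : ℕ} (h : ∀ q', q = q' + 1 → ExactOn a b S q')
    {f : Finset (Fin e) → B} (hf : SuppOn (insert l S) q f) (hd : koszulD b f = 0) :
    ∃ g, SuppOn (insert l S) (q + 1) g ∧ SuppOn S q (f - koszulD a g) ∧
      koszulD b (f - koszulD a g) = 0 := by
  obtain ⟨w, hw, hw'⟩ : ∃ w, SuppOn S q w ∧ koszulD a w = link l f := by
    cases q with
    | zero => exact ⟨0, SuppOn.zero _ _, by rw [hf.link_zero, map_zero]⟩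
    | succ q =>
      refine h q rfl _ hf.link ?_
      have := link_koszulD hl b hf
      rw [hd] at this
      rw [← neg_eq_zero, ← this]
      funext J
      simp [link]
  obtain ⟨g, hg, hg'⟩ := exists_sub_koszulD_suppOn hl a hf hw hw'
  exact ⟨g, hg, hg', by rw [map_sub, hd, koszulD_koszulD a b hab, sub_zero]⟩

lemma ExactOn.insert {l : Fin e} {S : Finset (Fin e)}
    (hl : ∀ x ∈ S, l < x) {q : ℕ} (h : ∀ q', q = q' + 1 → ExactOn a b S q')
    (h' : ExactOn a b S q) : ExactOn a b (insert l S) q := by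
  intro f hf hd
  obtain ⟨g, hg, hg', hg''⟩ := ExactOn.exists_sub_suppOn hab hl h hf hd
  obtain ⟨g', h1, h2⟩ := h' _ hg' hg''
  exact ⟨g + g', hg.add (h1.mono (Finset.subset_insert _ _)), by rw [map_add, h2]; abel⟩

/-- The family with the single nonzero value `w` at `S`. -/
def single (S : Finset (Fin e)) (w : A) : Finset (Fin e) → A := fun J => if J = S then w else 0

omit hab in
lemma suppOn_single (S : Finset (Fin e)) (w : A) : SuppOn S S.card (single S w) := by
  intro J hJ
  unfold single at hJ
  split_ifs at hJ with h
  · subst h; exact ⟨subset_rfl, rfl⟩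
  · exact absurd rfl hJ

omit hab in
lemma SuppOn.eq_single {S : Finset (Fin e)} {f : Finset (Fin e) → A} (hf : SuppOn S S.card f) :
    f = single S (f S) := by
  funext J
  unfold single
  split_ifs with h
  · rw [h]
  · by_contra h0
    have := hf J h0
    exact h (Finset.eq_of_subset_of_card_le this.1 this.2.ge)

omit hab in
lemma apply_eq_zero_of_koszulD_single {S : Finset (Fin e)} {w : A} {a : Fin e → A →ₗ[k] B}
    (h : koszulD a (single S w) = 0) {m : Fin e} (hm : m ∈ S) : a m w = 0 := by
  have h1 := congrFun h (S.erase m)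
  rw [koszulD_apply, Finset.sum_eq_single_of_mem m (by simp)] at h1
  · rw [Finset.insert_erase hm, single, if_pos rfl] at h1
    have := congrArg (sgn m (S.erase m) • ·) h1
    simpa [smul_smul, sgn_mul_self] using this
  · intro l hl hlm
    rw [single, if_neg, map_zero, smul_zero]
    intro h'
    have : m ∈ Insert.insert l (S.erase m) := by rw [h']; exact hm
    simp [hlm.symm] at this

/-- Exactness of the strands on at most `r` vertices, below the top. -/
lemma exactOn_of_card_le {r : ℕ}
    (H : ∀ (S : Finset (Fin e)) (l : Fin e), l ∉ S → S.card < r → ∀ w : B,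
      (∀ m ∈ S, b m w = 0) → ∃ w' : A, a l w' = w ∧ ∀ m ∈ S, a m w' = 0)
    (S : Finset (Fin e)) : ∀ q, S.card ≤ r → q < S.card → ExactOn a b S q := by
  induction S using Finset.induction_on_min with
  | empty => intro q _ h; simp at h
  | insert l S hl ih =>
    intro q hr hq
    have hlS : l ∉ S := fun h => (hl l h).false
    rw [Finset.card_insert_of_notMem hlS] at hr hq
    rcases Nat.lt_succ_iff_lt_or_eq.1 hq with hq | rfl
    · exact ExactOn.insert hab hl (fun q' hq' => ih q' (by omega) (by omega))
        (ih q (by omega) hq)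
    · intro f hf hd
      obtain ⟨g, hg, hg', hg''⟩ := ExactOn.exists_sub_suppOn hab hl
        (fun q' hq' => ih q' (by omega) (by omega)) hf hd
      -- Now `f'` is concentrated at the single face `S`, and being a cycle its value there is
      -- killed by `b m` for all `m ∈ S`. `H` lifts that value to `w'`, which is placed on `S ∪
      -- {l}`: deleting `l` returns `f' S`, and deleting `m ∈ S` gives `± a m w' = 0`.
      set f' := f - koszulD a g with hf'
      rw [hg'.eq_single] at hg''
      obtain ⟨w', hw, hw'⟩ := H S l hlS (by omega) (f' S)
        fun m hm => apply_eq_zero_of_koszulD_single hg'' hm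
      have hs : SuppOn (Insert.insert l S) (S.card + 1) (single (Insert.insert l S) w') := by
        have := suppOn_single (Insert.insert l S) w'
        rwa [Finset.card_insert_of_notMem hlS] at this
      refine ⟨g + single (Insert.insert l S) w', hg.add hs, ?_⟩
      have : koszulD a (single (Insert.insert l S) w') = f' := by
        refine (SuppOn.of_link_eq_zero (l := l) (S := S) (q := S.card) (hs.koszulD a)
          ?_).eq_single.trans ?_
        · rw [link_koszulD hl a hs]
          have h1 : link l (single (Insert.insert l S) w') = single S w' := by
            funext J
            unfold link single
            by_cases h : l ∈ J
            · rw [if_pos h, if_neg]; rintro rfl; exact hlS h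
            · rw [if_neg h]
              congr 1
              rw [eq_iff_iff]
              refine ⟨fun h' => ?_, fun h' => by rw [h']⟩
              rw [← Finset.erase_insert h, h', Finset.erase_insert hlS]
          rw [h1]
          funext J
          rw [Pi.neg_apply, koszulD_apply, Pi.zero_apply, neg_eq_zero]
          refine Finset.sum_eq_zero fun m hm => ?_
          unfold single
          split_ifs with h
          · rw [hw' m (h ▸ Finset.mem_insert_self _ _), smul_zero]
          · simp
        · conv_rhs => rw [hg'.eq_single]
          congr 1
          rw [koszulD_apply, Finset.sum_eq_single_of_mem l (by simpa using hlS)]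
          · rw [single, if_pos rfl, hw, sgn_of_forall_lt hl, one_smul]
          · intro m hm hml
            rw [single, if_neg, map_zero, smul_zero]
            intro h
            have : m ∈ Insert.insert l S := h ▸ Finset.mem_insert_self _ _
            rw [Finset.mem_insert] at this
            exact (Finset.mem_compl.1 hm) (this.resolve_left hml)
      rw [map_add, this, hf']; abel

/-- Exactness of the strands on at least `r` vertices. -/
lemma exactOn_of_le_card {r : ℕ}
    (H : ∀ (S : Finset (Fin e)) (l : Fin e), l ∉ S → S.card < r → ∀ w : B,
      (∀ m ∈ S, b m w = 0) → ∃ w' : A, a l w' = w ∧ ∀ m ∈ S, a m w' = 0)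
    (Q : Prop) (H' : Q → ∀ S : Finset (Fin e), S.card = r → ∀ w : B, (∀ m ∈ S, b m w = 0) → w = 0)
    (S : Finset (Fin e)) : ∀ q, r ≤ S.card → (q < r ∨ Q) → ExactOn a b S q := by
  -- On exactly `r` vertices only `q = r` is not covered already, and it requires joint injectivity
  -- of the `b m`. This is what `Q` switches on: it holds for `D_{p+1}`, but for `D_0` only the
  -- sizes `q < r` are claimed.
  have base : ∀ S : Finset (Fin e), S.card = r → ∀ q, (q < r ∨ Q) → ExactOn a b S q := by
    intro S hS q hq
    rcases lt_trichotomy q S.card with h | rfl | h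
    · exact exactOn_of_card_le hab H S q hS.le h
    · have hQ : Q := hq.resolve_left (by omega)
      intro f hf hd
      refine ⟨0, SuppOn.zero _ _, ?_⟩
      have h0 : f S = 0 := H' hQ S hS _ fun m hm => by
        rw [hf.eq_single] at hd
        exact apply_eq_zero_of_koszulD_single hd hm
      rw [map_zero, hf.eq_single, h0]
      funext J
      simp [single]
    · intro f hf _
      exact ⟨0, SuppOn.zero _ _, by rw [hf.eq_zero_of_card_lt h, map_zero]⟩
  induction S using Finset.induction_on_min with
  | empty => exact fun q hS hq => base _ (by simpa using (Nat.le_zero.1 hS).symm) q hq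
  | insert l S hl ih =>
    intro q hr hq
    have hlS : l ∉ S := fun h => (hl l h).false
    rcases hr.eq_or_lt with h | h
    · exact base _ h.symm q hq
    rw [Finset.card_insert_of_notMem hlS] at h
    exact ExactOn.insert hab hl
      (fun q' hq' => ih q' (by omega) (hq.imp_left (by omega))) (ih q (by omega) hq)

end Triple

end Koszul


/-! ### The strand near `U`, where contractions give way to determinants. -/

section Ends

variable {k : Type*} [Field k] {e : ℕ} {A B V : Type*} [AddCommGroup A] [Module k A]
  [AddCommGroup B] [Module k B] [AddCommGroup V] [Module k V]

/-- Pairs of `J` and `m ∉ J` are regrouped by `K = J ∪ {m}`; the identities assumed below are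
indexed by such a `K`. -/
lemma sum_compl_eq_sum_erase {e : ℕ} {M : Type*} [AddCommMonoid M]
    (F : Fin e → Finset (Fin e) → M) :
    ∑ J, ∑ m ∈ Jᶜ, F m J = ∑ K, ∑ m ∈ K, F m (K.erase m) := by
  rw [Finset.sum_sigma', Finset.sum_sigma']
  refine Finset.sum_bij' (fun x _ => ⟨insert x.2 x.1, x.2⟩) (fun x _ => ⟨x.1.erase x.2, x.2⟩)
    ?_ ?_ ?_ ?_ ?_ <;> rintro ⟨J, m⟩ h <;> simp_all

/-- The second differential of a strand, given by a family `η` of linear forms. -/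
def splice (η : Finset (Fin e) → B →ₗ[k] k) : (Finset (Fin e) → B) →ₗ[k] (Fin e → k) :=
  LinearMap.pi fun l => ∑ J with l ∉ J, sgn l J • (η J ∘ₗ LinearMap.proj (insert l J))

lemma splice_apply (η : Finset (Fin e) → B →ₗ[k] k) (f : Finset (Fin e) → B) (l : Fin e) :
    splice η f l = ∑ J with l ∉ J, sgn l J • η J (f (insert l J)) := by
  simp [splice]

lemma splice_eq_zero_of_notMem (η : Finset (Fin e) → B →ₗ[k] k) {f : Finset (Fin e) → B}
    {S : Finset (Fin e)} {q : ℕ} (hf : SuppOn S q f) {l : Fin e} (hl : l ∉ S) :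
    splice η f l = 0 := by
  rw [splice_apply]
  refine Finset.sum_eq_zero fun J _ => ?_
  by_cases h : f (insert l J) = 0
  · simp [h]
  · exact absurd ((hf _ h).1 (Finset.mem_insert_self _ _)) hl

variable {a : Fin e → A →ₗ[k] B} {η : Finset (Fin e) → B →ₗ[k] k}

/-- The augmentation to `∧^r V` kills boundaries: grouped by the face from which a vertex is
deleted, each group is an instance of `hη`. -/
lemma sum_koszulD_eq_zero
    (hη : ∀ K w, ∑ l ∈ K, sgn l (K.erase l) • η (K.erase l) (a l w) = 0)
    (f : Finset (Fin e) → A) : ∑ J, η J (koszulD a f J) = 0 := by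
  simp only [koszulD_apply, map_sum, map_zsmul]
  rw [sum_compl_eq_sum_erase (fun l J => sgn l J • η J (a l (f (insert l J))))]
  refine Finset.sum_eq_zero fun K _ => ?_
  rw [← hη K (f K)]
  exact Finset.sum_congr rfl fun l hl => by rw [Finset.insert_erase hl]

/-- In the coordinate at `l`, anticommuting the two deletions pulls out the sign of `l`. What
remains for each `K ∌ l` is `hη` on `K`, applied to the value of `f` at `K ∪ {l}`. -/
lemma splice_koszulD (hη : ∀ K w, ∑ l ∈ K, sgn l (K.erase l) • η (K.erase l) (a l w) = 0)
    (f : Finset (Fin e) → A) : splice η (koszulD a f) = 0 := by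
  funext l
  have h : ∀ J : Finset (Fin e), l ∉ J → sgn l J • η J (koszulD a f (insert l J)) =
      ∑ m ∈ Jᶜ, if m = l then 0 else
        -(sgn m J * sgn l (insert m J)) • η J (a m (f (insert l (insert m J)))) := by
    intro J hJ
    rw [koszulD_apply, map_sum, Finset.smul_sum]
    have hsub : (insert l J)ᶜ ⊆ Jᶜ :=
      Finset.compl_subset_compl.2 (Finset.subset_insert _ _)
    rw [← Finset.sum_subset hsub]
    · refine Finset.sum_congr rfl fun m hm => ?_
      simp only [Finset.mem_compl, Finset.mem_insert, not_or] at hm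
      rw [if_neg hm.1, ← sgn_mul_sgn_insert hJ hm.2 (Ne.symm hm.1), Finset.insert_comm, map_zsmul,
        smul_smul]
    · intro m hm hm'
      simp only [Finset.mem_compl, Finset.mem_insert, not_or, not_and, not_not] at hm hm'
      rw [if_pos]
      by_contra h; exact hm (hm' h)
  rw [splice_apply, Finset.sum_congr rfl fun J hJ => h J (Finset.mem_filter.1 hJ).2,
    Finset.sum_filter]
  have h2 : ∀ J : Finset (Fin e), (if l ∉ J then ∑ m ∈ Jᶜ, (if m = l then 0 else
        -(sgn m J * sgn l (insert m J)) • η J (a m (f (insert l (insert m J))))) else 0) =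
      ∑ m ∈ Jᶜ, if l ∈ insert m J then 0 else
        -(sgn m J * sgn l (insert m J)) • η J (a m (f (insert l (insert m J)))) := by
    intro J
    by_cases h : l ∈ J
    · rw [if_neg (not_not.2 h)]
      refine (Finset.sum_eq_zero fun m _ => ?_).symm
      rw [if_pos (Finset.mem_insert_of_mem h)]
    · rw [if_pos h]
      refine Finset.sum_congr rfl fun m _ => ?_
      simp [h, eq_comm]
  rw [Finset.sum_congr rfl fun J _ => h2 J, sum_compl_eq_sum_erase (fun m J =>
    if l ∈ insert m J then 0 else
        -(sgn m J * sgn l (insert m J)) • η J (a m (f (insert l (insert m J)))))]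
  refine Finset.sum_eq_zero fun K _ => ?_
  by_cases hl : l ∈ K
  · refine Finset.sum_eq_zero fun m hm => ?_
    rw [if_pos]
    rwa [Finset.insert_erase hm]
  · have := congrArg (-(sgn l K) • ·) (hη K (f (insert l K)))
    simp only [smul_zero, Finset.smul_sum, smul_smul] at this
    rw [← this]
    refine Finset.sum_congr rfl fun m hm => ?_
    rw [Finset.insert_erase hm, if_neg hl]
    congr 1
    ring

lemma sum_splice_smul {s : Fin e → V}
    (hs : ∀ K w, ∑ l ∈ K, sgn l (K.erase l) • η (K.erase l) w • s l = 0)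
    (f : Finset (Fin e) → B) : ∑ l, splice η f l • s l = 0 := by
  have h : ∀ l, splice η f l • s l =
      ∑ J, if l ∈ J then 0 else sgn l J • η J (f (insert l J)) • s l := by
    intro l
    rw [splice_apply, Finset.sum_smul, Finset.sum_filter]
    refine Finset.sum_congr rfl fun J _ => ?_
    by_cases h : l ∈ J
    · simp [h]
    · rw [if_pos h, if_neg h, smul_assoc]
  rw [Finset.sum_congr rfl fun l _ => h l, Finset.sum_comm]
  have h2 : ∀ J : Finset (Fin e),
      (∑ l, if l ∈ J then 0 else sgn l J • η J (f (insert l J)) • s l) =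
      ∑ l ∈ Jᶜ, sgn l J • η J (f (insert l J)) • s l := by
    intro J
    rw [Finset.compl_eq_univ_sdiff, ← Finset.filter_notMem_eq_sdiff, Finset.sum_filter]
    simp only [ite_not]
  rw [Finset.sum_congr rfl fun J _ => h2 J,
    sum_compl_eq_sum_erase (fun l J => sgn l J • η J (f (insert l J)) • s l)]
  refine Finset.sum_eq_zero fun K _ => ?_
  rw [← hs K (f K)]
  exact Finset.sum_congr rfl fun l hl => by rw [Finset.insert_erase hl]

variable {r : ℕ}

/-- Exactness of the strand at `∧^r U`, augmented to `∧^r V`. -/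
lemma exists_koszulD_eq_of_sum_eq_zero
    (H : ∀ (S : Finset (Fin e)), r ≤ S.card → ∀ q < r, ∀ f : Finset (Fin e) → B,
      SuppOn S q f → ∃ g : Finset (Fin e) → A, SuppOn S (q + 1) g ∧ koszulD a g = f)
    (hinj : ∀ S : Finset (Fin e), S.card = r → Function.Injective (η S))
    (hη : ∀ K w, ∑ l ∈ K, sgn l (K.erase l) • η (K.erase l) (a l w) = 0)
    (S : Finset (Fin e)) : ∀ f : Finset (Fin e) → B, SuppOn S r f → ∑ J, η J (f J) = 0 →
      ∃ g : Finset (Fin e) → A, SuppOn S (r + 1) g ∧ koszulD a g = f := by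
  -- With at most `r` vertices there is at most one face of size `r`, namely `S`, and `η S` is
  -- injective.
  have base : ∀ S : Finset (Fin e), S.card ≤ r → ∀ f : Finset (Fin e) → B, SuppOn S r f →
      ∑ J, η J (f J) = 0 → ∃ g : Finset (Fin e) → A, SuppOn S (r + 1) g ∧ koszulD a g = f := by
    intro S hS f hf h0
    refine ⟨0, SuppOn.zero _ _, ?_⟩
    rw [map_zero]
    rcases hS.lt_or_eq with h | rfl
    · rw [hf.eq_zero_of_card_lt h]
    · rw [hf.eq_single] at h0 ⊢
      rw [Finset.sum_eq_single_of_mem S (Finset.mem_univ _)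
        (fun J _ hJ => by rw [single, if_neg hJ, map_zero]), single, if_pos rfl] at h0
      have : f S = 0 := hinj S rfl (by rw [h0, map_zero])
      rw [this]
      funext J
      simp [single]
  induction S using Finset.induction_on_min with
  | empty => exact base _ (by simp)
  | insert l S hl ih =>
    have hlS : l ∉ S := fun h => (hl l h).false
    rcases le_or_gt (Insert.insert l S).card r with h | h
    · exact base _ h
    rw [Finset.card_insert_of_notMem hlS] at h
    intro f hf h0
    -- The link lives on faces of size `r - 1`, where `H` makes every chain a boundary, with no
    -- cycle condition.
    obtain ⟨w, hw, hw'⟩ : ∃ w, SuppOn S r w ∧ koszulD a w = link l f := by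
      cases r with
      | zero => exact ⟨0, SuppOn.zero _ _, by rw [hf.link_zero, map_zero]⟩
      | succ r => exact H S (by omega) r (by omega) _ hf.link
    obtain ⟨g, hg, hg'⟩ := exists_sub_koszulD_suppOn hl a hf hw hw'
    obtain ⟨g', h1, h2⟩ := ih _ hg' (by
      simp only [Pi.sub_apply, map_sub, Finset.sum_sub_distrib, h0, sum_koszulD_eq_zero hη,
        sub_zero])
    exact ⟨g + g', hg.add (h1.mono (Finset.subset_insert _ _)), by rw [map_add, h2]; abel⟩

/-- Exactness of the strand at `∧^{r+1} U`. -/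
lemma exists_koszulD_eq_of_splice_eq_zero
    (H : ∀ (S : Finset (Fin e)), r ≤ S.card → ∀ q < r, ∀ f : Finset (Fin e) → B,
      SuppOn S q f → ∃ g : Finset (Fin e) → A, SuppOn S (q + 1) g ∧ koszulD a g = f)
    (hinj : ∀ S : Finset (Fin e), S.card = r → Function.Injective (η S))
    (hη : ∀ K w, ∑ l ∈ K, sgn l (K.erase l) • η (K.erase l) (a l w) = 0)
    (S : Finset (Fin e)) : ∀ f : Finset (Fin e) → B, SuppOn S (r + 1) f → splice η f = 0 →
      ∃ g : Finset (Fin e) → A, SuppOn S (r + 2) g ∧ koszulD a g = f := by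
  induction S using Finset.induction_on_min with
  | empty =>
    intro f hf _
    exact ⟨0, SuppOn.zero _ _, by rw [hf.eq_zero_of_card_lt (by simp), map_zero]⟩
  | insert l S hl ih =>
    intro f hf h0
    obtain ⟨w, hw, hw'⟩ : ∃ w, SuppOn S (r + 1) w ∧ koszulD a w = link l f := by
      -- As `l` is the first vertex its signs are all `1`, so the coordinate at `l` of `splice η f`
      -- is exactly the augmentation of the link.
      refine exists_koszulD_eq_of_sum_eq_zero H hinj hη S _ hf.link ?_
      rw [← show splice η f l = 0 by rw [h0]; rfl, splice_apply, Finset.sum_filter]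
      refine Finset.sum_congr rfl fun J _ => ?_
      unfold link
      by_cases hJ : l ∈ J
      · simp [hJ]
      rw [if_neg hJ, if_pos hJ]
      by_cases h1 : f (Insert.insert l J) = 0
      · simp [h1]
      rw [sgn_of_forall_lt, one_smul]
      intro x hx
      refine hl x ((Finset.mem_insert.1 ((hf _ h1).1 (Finset.mem_insert_of_mem hx))).resolve_left ?_)
      rintro rfl
      exact hJ hx
    obtain ⟨g, hg, hg'⟩ := exists_sub_koszulD_suppOn hl a hf hw hw'
    obtain ⟨g', h1, h2⟩ := ih _ hg' (by rw [map_sub, h0, splice_koszulD hη, sub_zero])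
    exact ⟨g + g', hg.add (h1.mono (Finset.subset_insert _ _)), by rw [map_add, h2]; abel⟩

/-- Exactness of the strand at `U`. -/
lemma exists_splice_eq {s : Fin e → V}
    (hind : ∀ S : Finset (Fin e), S.card ≤ r → ∀ u : Fin e → k, (∀ l ∉ S, u l = 0) →
      ∑ l, u l • s l = 0 → u = 0)
    (hsurj : ∀ S : Finset (Fin e), S.card = r → Function.Surjective (η S))
    (hs : ∀ K w, ∑ l ∈ K, sgn l (K.erase l) • η (K.erase l) w • s l = 0)
    (S : Finset (Fin e)) : ∀ u : Fin e → k, (∀ l ∉ S, u l = 0) → ∑ l, u l • s l = 0 →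
      ∃ f : Finset (Fin e) → B, SuppOn S (r + 1) f ∧ splice η f = u := by
  induction S using Finset.induction_on with
  | empty =>
    intro u hu h0
    exact ⟨0, SuppOn.zero _ _, by rw [map_zero, hind ∅ (by simp) u hu h0]⟩
  | insert l S hlS ih =>
    intro u hu h0
    rcases le_or_gt (insert l S).card r with h | h
    · exact ⟨0, SuppOn.zero _ _, by rw [map_zero, hind _ h u hu h0]⟩
    rw [Finset.card_insert_of_notMem hlS] at h
    -- The Cramer relation on `R ∪ {l}`, scaled through surjectivity of `η R`, has coefficient `u l`
    -- at `l`. Subtracting it leaves a relation supported on `S`.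
    obtain ⟨R, hRS, hR⟩ := Finset.exists_subset_card_eq (show r ≤ S.card by omega)
    have hlR : l ∉ R := fun h => hlS (hRS h)
    obtain ⟨w, hw⟩ := hsurj R hR (sgn l R • u l)
    have hf : SuppOn (insert l S) (r + 1) (single (insert l R) w) := by
      have := suppOn_single (insert l R) w
      rw [Finset.card_insert_of_notMem hlR, hR] at this
      exact this.mono (Finset.insert_subset_insert _ hRS)
    have hl : splice η (single (insert l R) w) l = u l := by
      rw [splice_apply, Finset.sum_eq_single_of_mem R (by simpa using hlR)]
      · rw [single, if_pos rfl, hw, smul_smul, sgn_mul_self, one_smul]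
      · intro J hJ hJR
        rw [single, if_neg, map_zero, smul_zero]
        intro h
        have hJ' : l ∉ J := (Finset.mem_filter.1 hJ).2
        rw [← Finset.erase_insert hJ', h, Finset.erase_insert hlR] at hJR
        exact hJR rfl
    obtain ⟨f', h1, h2⟩ := ih (u - splice η (single (insert l R) w))
      (fun m hm => by
        by_cases hml : m = l
        · rw [hml, Pi.sub_apply, hl, sub_self]
        · have : m ∉ insert l S := by simp [hml, hm]
          rw [Pi.sub_apply, hu m this, splice_eq_zero_of_notMem η hf this, sub_self])
      (by simp only [Pi.sub_apply, sub_smul, Finset.sum_sub_distrib, h0, sum_splice_smul hs,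
            sub_zero])
    exact ⟨single (insert l R) w + f', hf.add (h1.mono (Finset.subset_insert _ _)),
      by rw [map_add, h2]; abel⟩

end Ends


/-! ### Contractions on divided powers. -/

section DividedPowers

variable {k : Type u} [Field k] {V : Type u} [AddCommGroup V] [Module k V]

/-- Division by a basis vector in the symmetric algebra, discarding remainders. -/
lemma exists_symmetricAlgebra_div {κ : Type*} (b : Module.Basis κ k V) (i : κ) :
    ∃ θ : SymmetricAlgebra k V →ₗ[k] SymmetricAlgebra k V, θ 1 = 0 ∧
      (∀ x, θ (SymmetricAlgebra.ι k V (b i) * x) = x) ∧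
      (∀ j, j ≠ i → ∀ x, θ (SymmetricAlgebra.ι k V (b j) * x) =
        SymmetricAlgebra.ι k V (b j) * θ x) := by
  classical
  let E := SymmetricAlgebra.equivMvPolynomial (R := k) b
  let D : MvPolynomial κ k →ₗ[k] MvPolynomial κ k :=
    { toFun := fun x => x.divMonomial (Finsupp.single i 1)
      map_add' := fun x y => MvPolynomial.add_divMonomial _ _ _
      map_smul' := fun c x => by
        ext m
        simp [MvPolynomial.coeff_divMonomial, MvPolynomial.coeff_smul] }
  refine ⟨E.symm.toLinearMap ∘ₗ D ∘ₗ E.toLinearMap, ?_, fun x => ?_, fun j hj x => ?_⟩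
  · have : D 1 = 0 := by
      ext m
      simp only [D, LinearMap.coe_mk, AddHom.coe_mk, MvPolynomial.coeff_divMonomial,
        MvPolynomial.coeff_one, MvPolynomial.coeff_zero, ite_eq_right_iff]
      intro h
      have := DFunLike.congr_fun h i
      simp only [Finsupp.coe_zero, Pi.zero_apply, Finsupp.coe_add, Pi.add_apply,
        Finsupp.single_eq_same] at this
      omega
    simp [this]
  · have : D (MvPolynomial.X i * E x) = E x := MvPolynomial.X_mul_divMonomial _ _
    simp [E] at this ⊢
    simp [this]
  · have : D (MvPolynomial.X j * E x) = MvPolynomial.X j * D (E x) := by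
      ext m
      simp only [D, LinearMap.coe_mk, AddHom.coe_mk, MvPolynomial.coeff_divMonomial,
        MvPolynomial.coeff_X_mul']
      have h : j ∈ (Finsupp.single i 1 + m).support ↔ j ∈ m.support := by
        simp [hj.symm]
      by_cases h' : j ∈ m.support
      · rw [if_pos (h.2 h'), if_pos h']
        congr 1
        rw [add_tsub_assoc_of_le]
        rw [Finsupp.single_le_iff]
        exact Nat.one_le_iff_ne_zero.2 (Finsupp.mem_support_iff.1 h')
      · rw [if_neg (fun h'' => h' (h.1 h'')), if_neg h']
    simp [E] at this ⊢
    simp [this]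

lemma symPow_succ_induction {κ : Type*} (b : Module.Basis κ k V) {p : ℕ}
    {P : SymmetricAlgebra k V → Prop}
    (hmul : ∀ j, ∀ x ∈ SymPow k V p, P (SymmetricAlgebra.ι k V (b j) * x))
    (hadd : ∀ x y, P x → P y → P (x + y)) (hsmul : ∀ (c : k) x, P x → P (c • x)) (h0 : P 0)
    {x : SymmetricAlgebra k V} (hx : x ∈ SymPow k V (p + 1)) : P x := by
  rw [SymPow, pow_succ'] at hx
  refine Submodule.mul_induction_on hx ?_ hadd
  rintro _ ⟨v, rfl⟩ y hy
  have hv : v ∈ Submodule.span k (Set.range b) := by rw [b.span_eq]; trivial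
  induction hv using Submodule.span_induction with
  | mem v hv => obtain ⟨j, rfl⟩ := hv; exact hmul j y hy
  | zero => simpa using h0
  | add v w _ _ hv hw => rw [map_add, add_mul]; exact hadd _ _ hv hw
  | smul c v _ hv => rw [map_smul, smul_mul_assoc]; exact hsmul _ _ hv

lemma exists_eq_smul_one_of_mem_symPow_zero {x : SymmetricAlgebra k V} (hx : x ∈ SymPow k V 0) :
    ∃ c : k, x = c • 1 := by
  rw [SymPow, pow_zero, Submodule.mem_one] at hx
  obtain ⟨c, rfl⟩ := hx
  exact ⟨c, Algebra.algebraMap_eq_smul_one c⟩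

/-- Division lowers the degree by one: it cancels `b i` and passes through the other generators to a
factor of smaller degree. The induction starts because it kills constants. -/
lemma div_mem_symPow {κ : Type*} (b : Module.Basis κ k V) (i : κ)
    {θ : SymmetricAlgebra k V →ₗ[k] SymmetricAlgebra k V} (h1 : θ 1 = 0)
    (hi : ∀ x, θ (SymmetricAlgebra.ι k V (b i) * x) = x)
    (hj : ∀ j, j ≠ i → ∀ x, θ (SymmetricAlgebra.ι k V (b j) * x) =
        SymmetricAlgebra.ι k V (b j) * θ x) (p : ℕ) :
    ∀ x ∈ SymPow k V (p + 1), θ x ∈ SymPow k V p := by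
  induction p with
  | zero =>
    intro x hx
    refine symPow_succ_induction (P := fun x => θ x ∈ SymPow k V 0) b ?_ ?_ ?_ ?_ hx
    · intro j x hx
      by_cases h : j = i
      · rw [h, hi]; exact hx
      · obtain ⟨c, rfl⟩ := exists_eq_smul_one_of_mem_symPow_zero hx
        rw [hj j h, map_smul, h1, smul_zero, mul_zero]
        exact zero_mem _
    · intro x y hx hy; rw [map_add]; exact add_mem hx hy
    · intro c x hx; rw [map_smul]; exact Submodule.smul_mem _ _ hx
    · rw [map_zero]; exact zero_mem _
  | succ p ih =>
    intro x hx
    refine symPow_succ_induction (P := fun x => θ x ∈ SymPow k V (p + 1)) b ?_ ?_ ?_ ?_ hx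
    · intro j x hx
      by_cases h : j = i
      · rw [h, hi]; exact hx
      · rw [hj j h, SymPow, pow_succ']
        exact Submodule.mul_mem_mul (LinearMap.mem_range_self _ _) (ih x hx)
    · intro x y hx hy; rw [map_add]; exact add_mem hx hy
    · intro c x hx; rw [map_smul]; exact Submodule.smul_mem _ _ hx
    · rw [map_zero]; exact zero_mem _

variable (k V) in
/-- Elements of the divided power, as linear forms. -/
def divPowEquiv (p : ℕ) : DivPow k V p ≃ₗ[k] Module.Dual k (SymPow k V p) :=
  LinearEquiv.refl k (Module.Dual k (SymPow k V p))

lemma divPowEquiv_contract (v : V) (p : ℕ) (w : DivPow k V (p + 1)) (x : SymPow k V p) :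
    divPowEquiv k V p (contract k v p w) x = divPowEquiv k V (p + 1) w (symMul k v p x) := rfl

lemma divPowZero_apply (w : DivPow k V 0) : divPowZero k V w = divPowEquiv k V 0 w
    ⟨1, by rw [SymPow, pow_zero]; exact Submodule.one_le.mp le_rfl⟩ := rfl

lemma coe_symMul (v : V) (p : ℕ) (x : SymPow k V p) :
    (symMul k v p x : SymmetricAlgebra k V) = SymmetricAlgebra.ι k V v * x := rfl

lemma contract_comm (v u : V) (p : ℕ) (w : DivPow k V (p + 2)) :
    contract k v p (contract k u (p + 1) w) = contract k u p (contract k v (p + 1) w) := by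
  apply (divPowEquiv k V p).injective
  ext x
  rw [divPowEquiv_contract, divPowEquiv_contract, divPowEquiv_contract, divPowEquiv_contract]
  congr 1
  ext
  simp only [coe_symMul]
  exact mul_left_comm _ _ _

lemma eq_zero_of_contract_eq_zero {κ : Type*} (b : Module.Basis κ k V) {p : ℕ}
    {w : DivPow k V (p + 1)} (h : ∀ i, contract k (b i) p w = 0) : w = 0 := by
  apply (divPowEquiv k V (p + 1)).injective
  ext ⟨x, hx⟩
  rw [map_zero, LinearMap.zero_apply]
  -- The membership proof goes inside the predicate so that the induction can range over elements of
  -- the whole algebra.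
  suffices H : ∃ hx : x ∈ SymPow k V (p + 1), divPowEquiv k V (p + 1) w ⟨x, hx⟩ = 0 from H.2
  refine symPow_succ_induction (P := fun x => ∃ hx : x ∈ SymPow k V (p + 1),
    divPowEquiv k V (p + 1) w ⟨x, hx⟩ = 0) b ?_ ?_ ?_ ?_ hx
  · intro j x hx
    refine ⟨(symMul k (b j) p ⟨x, hx⟩).2, ?_⟩
    have := congrArg (fun w => divPowEquiv k V p w ⟨x, hx⟩) (h j)
    simp only [divPowEquiv_contract, map_zero, LinearMap.zero_apply] at this
    exact this
  · rintro x y ⟨hx, hx'⟩ ⟨hy, hy'⟩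
    refine ⟨add_mem hx hy, ?_⟩
    rw [← add_zero (0 : k)]
    nth_rewrite 1 [← hx']
    rw [← hy', ← map_add]
    rfl
  · rintro c x ⟨hx, hx'⟩
    refine ⟨Submodule.smul_mem _ c hx, ?_⟩
    rw [← smul_zero c, ← hx', ← map_smul]
    rfl
  · exact ⟨zero_mem _, map_zero _⟩

/-- Precomposing the linear form `w` with division by `b i` gives `w'`. Division undoes
multiplication by `b i` and commutes with multiplication by the other `b m`, so their annihilation
of `w` passes to `w'`. -/
lemma exists_contract_eq {κ : Type*} (b : Module.Basis κ k V) (i : κ) (p : ℕ) (w : DivPow k V p)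
    (T : Set κ) (hT : i ∉ T) (h : ∀ q (hq : p = q + 1), ∀ m ∈ T, contract k (b m) q (hq ▸ w) = 0) :
    ∃ w' : DivPow k V (p + 1), contract k (b i) p w' = w ∧
      ∀ m ∈ T, contract k (b m) p w' = 0 := by
  obtain ⟨θ, h1, hi, hj⟩ := exists_symmetricAlgebra_div b i
  have hθ := div_mem_symPow b i h1 hi hj
  refine ⟨(divPowEquiv k V (p + 1)).symm (divPowEquiv k V p w ∘ₗ θ.restrict (hθ p)), ?_, ?_⟩
  · apply (divPowEquiv k V p).injective
    ext x
    rw [divPowEquiv_contract, LinearEquiv.apply_symm_apply, LinearMap.comp_apply]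
    congr 1
    ext
    exact hi _
  · intro m hm
    have hmi : m ≠ i := fun h => hT (h ▸ hm)
    apply (divPowEquiv k V p).injective
    ext x
    rw [divPowEquiv_contract, LinearEquiv.apply_symm_apply, LinearMap.comp_apply, map_zero,
      LinearMap.zero_apply]
    -- On `D_0` no contraction is available and `h` is vacuous; the vanishing comes instead from
    -- division killing constants.
    cases p with
    | zero =>
      convert map_zero (divPowEquiv k V 0 w)
      ext
      obtain ⟨c, hc⟩ := exists_eq_smul_one_of_mem_symPow_zero x.2
      change θ (SymmetricAlgebra.ι k V (b m) * x) = 0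
      rw [hj m hmi, hc, map_smul, h1, smul_zero, mul_zero]
    | succ q =>
      have := h q rfl m hm
      rw [← LinearMap.zero_apply (σ₁₂ := RingHom.id k) (⟨θ x, hθ q x x.2⟩ : SymPow k V q),
        ← map_zero (divPowEquiv k V q), ← this, divPowEquiv_contract]
      congr 1
      ext
      exact hj m hmi _

lemma divPowZero_bijective : Function.Bijective (divPowZero k V) := by
  constructor
  · rw [injective_iff_map_eq_zero]
    intro w hw
    apply (divPowEquiv k V 0).injective
    ext x
    obtain ⟨c, hc⟩ := exists_eq_smul_one_of_mem_symPow_zero x.2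
    have hx : x = c • ⟨1, by rw [SymPow, pow_zero]; exact Submodule.one_le.mp le_rfl⟩ :=
      Subtype.ext hc
    rw [hx, map_smul, ← divPowZero_apply, hw]
    simp
  · intro c
    refine ⟨(divPowEquiv k V 0).symm (c • (SymmetricAlgebra.algebraMapInv (R := k)
      (M := V)).toLinearMap.domRestrict _), ?_⟩
    rw [divPowZero_apply, LinearEquiv.apply_symm_apply]
    simp

instance finite_symPow [Module.Finite k V] (p : ℕ) : Module.Finite k (SymPow k V p) := by
  rw [Module.Finite.iff_fg, SymPow, LinearMap.range_eq_map]
  exact Submodule.FG.pow (Submodule.FG.map _ Module.Finite.fg_top) p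

instance finite_divPow [Module.Finite k V] (p : ℕ) : Module.Finite k (DivPow k V p) :=
  Module.Finite.equiv (divPowEquiv k V p).symm

end DividedPowers

/-! ### Determinants on `V` and Cramer's relation. -/

section TopForms

variable {k : Type u} [Field k] {V : Type u} [AddCommGroup V] [Module k V] [Module.Finite k V]
  {r : ℕ}

lemma finrank_topDual (hV : Module.finrank k V = r) : Module.finrank k (TopDual k V r) = 1 := by
  rw [exteriorPower.finrank_eq, Subspace.dual_finrank_eq, hV, Nat.choose_self]

lemma pairWith_bijective (hV : Module.finrank k V = r) {v : Fin r → V}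
    (hv : LinearIndependent k v) : Function.Bijective (pairWith k v) := by
  let b := basisOfLinearIndependentOfCardEqFinrank' v hv (by simp [hV])
  -- The vectors `v` form a basis, and pairing with the wedge of the dual basis is the determinant
  -- of the identity matrix.
  have h1 : pairWith k v (exteriorPower.ιMulti k r b.coord) = 1 := by
    change exteriorPower.pairingDual k V r _ (exteriorPower.ιMulti k r v) = 1
    rw [exteriorPower.pairingDual_ιMulti_ιMulti, ← Matrix.det_one (n := Fin r)]
    congr 1
    ext i j
    have : v i = b i := by simp [b]
    rw [Matrix.of_apply, this, Module.Basis.coord_apply, Module.Basis.repr_self,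
      Finsupp.single_apply, Matrix.one_apply]
  have hs : Function.Surjective (pairWith k v) := fun c =>
    ⟨c • exteriorPower.ιMulti k r b.coord, by rw [map_smul, h1, smul_eq_mul, mul_one]⟩
  refine ⟨?_, hs⟩
  rwa [LinearMap.injective_iff_surjective_of_finrank_eq_finrank]
  rw [finrank_topDual hV, Module.finrank_self]

/-- Laplace expansion of the vanishing alternating form in `r + 1` vectors of a space of dimension
`r`. -/
lemma sum_pairWith_smul_eq_zero (hV : Module.finrank k V = r) {N : Type*} [AddCommGroup N]
    [Module k N] (h : V →ₗ[k] N) (ω : TopDual k V r) (v : Fin (r + 1) → V) :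
    ∑ i : Fin (r + 1), (-1 : ℤ) ^ (i : ℕ) • pairWith k (i.removeNth v) ω • h (v i) = 0 := by
  let P : V [⋀^Fin r]→ₗ[k] k :=
    (exteriorPower.pairingDual k V r ω).compAlternatingMap (exteriorPower.ιMulti k r)
  let F : V →ₗ[k] V [⋀^Fin r]→ₗ[k] N :=
    { toFun := fun x => (LinearMap.toSpanSingleton k N (h x)).compAlternatingMap P
      map_add' := fun x y => by ext; simp
      map_smul' := fun c x => by ext; simp [smul_comm c] }
  have hdep : ¬LinearIndependent k v := fun hli => by
    have := hli.fintype_card_le_finrank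
    simp [hV] at this
  have := (AlternatingMap.alternatizeUncurryFin F).map_linearDependent v hdep
  rw [AlternatingMap.alternatizeUncurryFin_apply] at this
  exact this

lemma sgn_orderEmbOfFin {e : ℕ} {K : Finset (Fin e)} {q : ℕ} (hK : K.card = q) (i : Fin q) :
    sgn (K.orderEmbOfFin hK i) (K.erase (K.orderEmbOfFin hK i)) = (-1) ^ (i : ℕ) := by
  have : (K.erase (K.orderEmbOfFin hK i)).filter (· < K.orderEmbOfFin hK i) =
      (Finset.univ.filter (· < i)).map (K.orderEmbOfFin hK).toEmbedding := by
    ext x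
    simp only [Finset.mem_filter, Finset.mem_erase, Finset.mem_map, Finset.mem_univ, true_and,
      RelEmbedding.coe_toEmbedding]
    constructor
    · rintro ⟨⟨_, hx⟩, hlt⟩
      rw [← Finset.mem_coe, ← Finset.range_orderEmbOfFin K hK] at hx
      obtain ⟨j, rfl⟩ := hx
      exact ⟨j, by simpa using hlt, rfl⟩
    · rintro ⟨j, hj, rfl⟩
      simp [hj, hj.ne]
  rw [sgn, this, Finset.card_map, Finset.filter_gt_eq_Iio, Fin.card_Iio]

lemma orderEmbOfFin_erase {e : ℕ} {K : Finset (Fin e)} {q : ℕ} (hK : K.card = q + 1)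
    (i : Fin (q + 1)) (h : (K.erase (K.orderEmbOfFin hK i)).card = q) :
    ((K.erase (K.orderEmbOfFin hK i)).orderEmbOfFin h : Fin q → Fin e) =
      i.removeNth (K.orderEmbOfFin hK) := by
  symm
  refine Finset.orderEmbOfFin_unique h (fun x => ?_) ?_
  · simp [Fin.removeNth]
  · exact (K.orderEmbOfFin hK).strictMono.comp (Fin.strictMono_succAbove i)

variable {e : ℕ} (s : Fin e → V)

variable (k r) in
/-- The linear form on `D_0 V* ⊗ ∧^r V*` given by pairing with `s_J`. -/
noncomputable def faceForm (J : Finset (Fin e)) : DivPow k V 0 ⊗[k] TopDual k V r →ₗ[k] k :=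
  if h : J.card = r then
    LinearMap.mul' k k ∘ₗ TensorProduct.map (divPowZero k V)
      (pairWith k fun t => s (J.orderEmbOfFin h t))
  else 0

omit [Module.Finite k V] in
lemma faceForm_tmul {J : Finset (Fin e)} (h : J.card = r) (w : DivPow k V 0)
    (ω : TopDual k V r) : faceForm k r s J (w ⊗ₜ ω) =
      divPowZero k V w * pairWith k (fun t => s (J.orderEmbOfFin h t)) ω := by
  simp [faceForm, h]

lemma faceForm_bijective (hV : Module.finrank k V = r) {J : Finset (Fin e)} (h : J.card = r)
    (hs : LinearIndependent k fun l : J => s l) : Function.Bijective (faceForm k r s J) := by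
  have h2 : LinearIndependent k fun t => s (J.orderEmbOfFin h t) :=
    hs.comp (fun t => (⟨J.orderEmbOfFin h t, J.orderEmbOfFin_mem h t⟩ : J)) fun x y hxy => by
      simpa using hxy
  have : faceForm k r s J = (TensorProduct.congr
      (LinearEquiv.ofBijective _ divPowZero_bijective)
      (LinearEquiv.ofBijective _ (pairWith_bijective hV h2)) ≪≫ₗ TensorProduct.lid k k :
        _ ≃ₗ[k] k).toLinearMap := by
    apply TensorProduct.ext'
    intro w ω
    rw [faceForm_tmul s h]
    simp
  rw [this]
  exact LinearEquiv.bijective _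

/-- Enumerating `K` increasingly turns its signs into `(-1)^i` and its faces into omissions of the
`i`th vector, so the Laplace expansion applies. Taking `h` a multiple of the identity serves `φ φ_2
= 0`; taking `h` the form on `V` given by an element of `D_1 V*` serves `φ_2 φ_3 = 0`. -/
lemma sum_faceForm_smul_aux (hV : Module.finrank k V = r) {N : Type*} [AddCommGroup N]
    [Module k N] (h : V →ₗ[k] N) (ω : TopDual k V r) {K : Finset (Fin e)} (hK : K.card = r + 1)
    (F : Fin e → N) (hF : ∀ l ∈ K, ∀ h' : (K.erase l).card = r,
      F l = pairWith k (fun t => s ((K.erase l).orderEmbOfFin h' t)) ω • h (s l)) :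
    ∑ l ∈ K, sgn l (K.erase l) • F l = 0 := by
  rw [← sum_pairWith_smul_eq_zero hV h ω (fun i => s (K.orderEmbOfFin hK i))]
  symm
  refine Finset.sum_bij (fun i _ => K.orderEmbOfFin hK i) (fun i _ => K.orderEmbOfFin_mem hK i)
    (fun i _ j _ hij => by simpa using hij) (fun l hl => ?_) (fun i _ => ?_)
  · rw [← Finset.mem_coe, ← Finset.range_orderEmbOfFin K hK] at hl
    obtain ⟨i, rfl⟩ := hl
    exact ⟨i, Finset.mem_univ _, rfl⟩
  · have h' : (K.erase (K.orderEmbOfFin hK i)).card = r := by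
      rw [Finset.card_erase_of_mem (K.orderEmbOfFin_mem hK i), hK]; rfl
    rw [hF _ (K.orderEmbOfFin_mem hK i) h', sgn_orderEmbOfFin, orderEmbOfFin_erase]
    rfl

omit [Module.Finite k V] in
lemma faceForm_erase_eq_zero {K : Finset (Fin e)} (hK : K.card ≠ r + 1) {l : Fin e} (hl : l ∈ K) :
    faceForm k r s (K.erase l) = 0 := by
  rw [faceForm, dif_neg]
  intro h
  have := Finset.card_erase_add_one hl
  omega

lemma sum_faceForm_smul (hV : Module.finrank k V = r) (K : Finset (Fin e))
    (w : DivPow k V 0 ⊗[k] TopDual k V r) :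
    ∑ l ∈ K, sgn l (K.erase l) • faceForm k r s (K.erase l) w • s l = 0 := by
  by_cases hK : K.card = r + 1
  · induction w using TensorProduct.induction_on with
    | zero => simp
    | add x y hx hy => simp only [map_add, add_smul, smul_add, Finset.sum_add_distrib, hx, hy,
        add_zero]
    | tmul w ω =>
      refine sum_faceForm_smul_aux s hV (divPowZero k V w • LinearMap.id) ω hK _ fun l _ h' => ?_
      rw [faceForm_tmul s h', mul_comm, mul_smul]
      rfl
  · exact Finset.sum_eq_zero fun l hl => by simp [faceForm_erase_eq_zero s hK hl]

lemma sum_faceForm_contract (hV : Module.finrank k V = r) (K : Finset (Fin e))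
    (w : DivPow k V 1 ⊗[k] TopDual k V r) :
    ∑ l ∈ K, sgn l (K.erase l) • faceForm k r s (K.erase l)
      (LinearMap.rTensor (TopDual k V r) (contract k (s l) 0) w) = 0 := by
  by_cases hK : K.card = r + 1
  · induction w using TensorProduct.induction_on with
    | zero => simp
    | add x y hx hy => simp only [map_add, smul_add, Finset.sum_add_distrib, hx, hy, add_zero]
    | tmul w ω =>
      let h : V →ₗ[k] k :=
        { toFun := fun v => divPowZero k V (contract k v 0 w)
          map_add' := fun v v' => by
            simp only [divPowZero_apply, divPowEquiv_contract]
            rw [← map_add]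
            congr 1
            ext
            simp [coe_symMul]
          map_smul' := fun c v => by
            simp only [divPowZero_apply, divPowEquiv_contract]
            rw [RingHom.id_apply, ← map_smul]
            congr 1
            ext
            simp [coe_symMul] }
      refine sum_faceForm_smul_aux s hV h ω hK _ fun l _ h' => ?_
      rw [LinearMap.rTensor_tmul, faceForm_tmul s h', mul_comm]
      rfl
  · exact Finset.sum_eq_zero fun l hl => by simp [faceForm_erase_eq_zero s hK hl]

end TopForms


/-! ### Twisting by a line. -/

section Tensor

variable {k : Type*} [Field k] {A B C L : Type*} [AddCommGroup A] [Module k A]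
  [AddCommGroup B] [Module k B] [AddCommGroup C] [Module k C] [AddCommGroup L] [Module k L]

/-- Tensoring with a one-dimensional space. -/
noncomputable def tensorLine (A : Type*) [AddCommGroup A] [Module k A] (ε : k ≃ₗ[k] L) :
    A ≃ₗ[k] A ⊗[k] L :=
  (TensorProduct.rid k A).symm ≪≫ₗ TensorProduct.congr (LinearEquiv.refl k A) ε

lemma rTensor_tensorLine (ε : k ≃ₗ[k] L) (f : A →ₗ[k] B) (x : A) :
    LinearMap.rTensor L f (tensorLine A ε x) = tensorLine B ε (f x) := by
  simp [tensorLine]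

lemma rTensor_eq_zero_iff (ε : k ≃ₗ[k] L) (f : A →ₗ[k] B) (w : A ⊗[k] L) :
    LinearMap.rTensor L f w = 0 ↔ f ((tensorLine A ε).symm w) = 0 := by
  obtain ⟨w, rfl⟩ := (tensorLine A ε).surjective w
  rw [rTensor_tensorLine, LinearEquiv.map_eq_zero_iff, LinearEquiv.symm_apply_apply]

lemma exists_rTensor_eq {ι : Type*} (ε : k ≃ₗ[k] L) {a : ι → A →ₗ[k] B} {b : ι → B →ₗ[k] C}
    {S : Finset ι} {l : ι}
    (H : ∀ w : B, (∀ m ∈ S, b m w = 0) → ∃ w' : A, a l w' = w ∧ ∀ m ∈ S, a m w' = 0)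
    (w : B ⊗[k] L) (hw : ∀ m ∈ S, LinearMap.rTensor L (b m) w = 0) :
    ∃ w' : A ⊗[k] L, LinearMap.rTensor L (a l) w' = w ∧
      ∀ m ∈ S, LinearMap.rTensor L (a m) w' = 0 := by
  simp only [rTensor_eq_zero_iff ε] at hw
  obtain ⟨w', h, h'⟩ := H _ hw
  refine ⟨tensorLine A ε w', ?_, fun m hm => ?_⟩
  · rw [rTensor_tensorLine, h, LinearEquiv.apply_symm_apply]
  · rw [rTensor_tensorLine, h' m hm, map_zero]

end Tensor

/-! ### Exactness of the strands over `k`. -/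

section Strand

variable {k : Type u} [Field k] {V : Type u} [AddCommGroup V] [Module k V] [Module.Finite k V]
  {r e : ℕ} {s : Fin e → V}

variable (k r s) in
/-- Contraction with `s l` on `D_{p+1} V* ⊗ ∧^r V*`. -/
noncomputable def contractTop (p : ℕ) (l : Fin e) :
    DivPow k V (p + 1) ⊗[k] TopDual k V r →ₗ[k] DivPow k V p ⊗[k] TopDual k V r :=
  LinearMap.rTensor (TopDual k V r) (contract k (s l) p)

omit [Module.Finite k V] in
lemma contractTop_comm (p : ℕ) (l m : Fin e) (w : DivPow k V (p + 2) ⊗[k] TopDual k V r) :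
    contractTop k r s p l (contractTop k r s (p + 1) m w) =
      contractTop k r s p m (contractTop k r s (p + 1) l w) := by
  unfold contractTop
  rw [← LinearMap.rTensor_comp_apply, ← LinearMap.rTensor_comp_apply]
  congr 2
  ext1 w
  exact contract_comm _ _ _ _

variable (hV : Module.finrank k V = r) (hre : r ≤ e)
  (hs : ∀ J : Finset (Fin e), J.card = r → LinearIndependent k fun l : J => s l)
include hV hs

/-- The form in which uniform rank enters the contraction arguments. -/
lemma exists_basis_of_card_eq {J : Finset (Fin e)} (hJ : J.card = r) :
    ∃ b : Module.Basis J k V, ∀ l, b l = s l :=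
  ⟨basisOfLinearIndependentOfCardEqFinrank' _ (hs J hJ) (by simp [hV, hJ]), fun l => by simp⟩

omit hs in
lemma exists_line_equiv : Nonempty (k ≃ₗ[k] TopDual k V r) :=
  ⟨LinearEquiv.ofFinrankEq _ _ (by rw [finrank_topDual hV, Module.finrank_self])⟩

lemma eq_zero_of_contractTop_eq_zero (p : ℕ) (S : Finset (Fin e)) (hS : S.card = r)
    (w : DivPow k V (p + 1) ⊗[k] TopDual k V r) (hw : ∀ m ∈ S, contractTop k r s p m w = 0) :
    w = 0 := by
  obtain ⟨ε⟩ := exists_line_equiv (k := k) hV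
  obtain ⟨b, hb⟩ := exists_basis_of_card_eq hV hs hS
  rw [← LinearEquiv.map_eq_zero_iff (tensorLine (DivPow k V (p + 1)) ε).symm]
  refine eq_zero_of_contract_eq_zero b fun i => ?_
  rw [hb, ← rTensor_eq_zero_iff]
  exact hw i i.2

include hre

/-- The set `S ∪ {l}` has at most `r` elements, and `r ≤ e` lets it grow to `r` vertices. Their
vectors form a basis, along which one divides by `s l`. -/
lemma exists_contract_eq_of_card_lt (p : ℕ) (w : DivPow k V p) (S : Finset (Fin e)) (l : Fin e)
    (hl : l ∉ S) (hS : S.card < r)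
    (h : ∀ q (hq : p = q + 1), ∀ m ∈ S, contract k (s m) q (hq ▸ w) = 0) :
    ∃ w' : DivPow k V (p + 1), contract k (s l) p w' = w ∧
      ∀ m ∈ S, contract k (s m) p w' = 0 := by
  obtain ⟨R, hSR, hR⟩ := Finset.exists_superset_card_eq (s := insert l S) (n := r)
    (by rw [Finset.card_insert_of_notMem hl]; omega) (by simpa using hre)
  obtain ⟨b, hb⟩ := exists_basis_of_card_eq hV hs hR
  have hlR : l ∈ R := hSR (Finset.mem_insert_self _ _)
  obtain ⟨w', h1, h2⟩ := exists_contract_eq b ⟨l, hlR⟩ p w {m | (m : Fin e) ∈ S} hl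
    fun q hq m hm => by rw [hb]; exact h q hq m hm
  refine ⟨w', by rw [← h1, hb], fun m hm => ?_⟩
  have := h2 ⟨m, hSR (Finset.mem_insert_of_mem hm)⟩ hm
  rwa [hb] at this

lemma exists_contractTop_eq (p : ℕ) (S : Finset (Fin e)) (l : Fin e) (hl : l ∉ S)
    (hS : S.card < r) (w : DivPow k V (p + 1) ⊗[k] TopDual k V r)
    (hw : ∀ m ∈ S, contractTop k r s p m w = 0) :
    ∃ w', contractTop k r s (p + 1) l w' = w ∧ ∀ m ∈ S, contractTop k r s (p + 1) m w' = 0 := by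
  obtain ⟨ε⟩ := exists_line_equiv (k := k) hV
  exact exists_rTensor_eq (a := fun l => contract k (s l) (p + 1))
    (b := fun l => contract k (s l) p) ε
    (fun w hw => exists_contract_eq_of_card_lt hV hre hs (p + 1) w S l hl hS
      fun q hq m hm => by obtain rfl := Nat.succ_injective hq; exact hw m hm) w hw

/-- Exactness of the strand at `D_{p+1} V* ⊗ ∧^{r+p+2} U`. -/
lemma exists_koszulD_contractTop_eq (S : Finset (Fin e)) (p : ℕ)
    (f : Finset (Fin e) → DivPow k V (p + 1) ⊗[k] TopDual k V r)
    (hf : SuppOn S (r + p + 2) f) (h : koszulD (contractTop k r s p) f = 0) :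
    ∃ g, SuppOn S (r + p + 3) g ∧ koszulD (contractTop k r s (p + 1)) g = f := by
  rcases le_or_gt r S.card with hS | hS
  -- The faces have more than `r` vertices, so `Q` has to be true; this is legitimate because
  -- contractions by a basis detect zero in `D_{p+1} V*`.
  · exact exactOn_of_le_card (contractTop_comm p) (exists_contractTop_eq hV hre hs p) True
      (fun _ => eq_zero_of_contractTop_eq_zero hV hs p) S _ hS (Or.inr trivial) f hf h
  · exact ⟨0, SuppOn.zero _ _, by rw [map_zero, hf.eq_zero_of_card_lt (by omega)]⟩

/-- Exactness of the strand at `D_0 V* ⊗ ∧^q U` for `q < r`. -/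
lemma exists_koszulD_contractTop_zero_eq (S : Finset (Fin e)) (hS : r ≤ S.card) (q : ℕ) (hq : q < r)
    (f : Finset (Fin e) → DivPow k V 0 ⊗[k] TopDual k V r) (hf : SuppOn S q f) :
    ∃ g, SuppOn S (q + 1) g ∧ koszulD (contractTop k r s 0) g = f := by
  obtain ⟨ε⟩ := exists_line_equiv (k := k) hV
  -- No contraction leaves `D_0 V*`, so zero maps stand in for it and every chain counts as a cycle.
  let b : Fin e → DivPow k V 0 ⊗[k] TopDual k V r →ₗ[k] PUnit.{u + 1} ⊗[k] TopDual k V r :=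
    fun _ => LinearMap.rTensor _ 0
  have hb : ∀ l w, b l w = 0 := fun l w => by simp [b]
  refine exactOn_of_le_card (a := contractTop k r s 0) (b := b)
    (fun l m w => (hb l _).trans (hb m _).symm) ?_
    False False.elim S q hS (Or.inl hq) f hf ?_
  · intro S l hl hS
    exact exists_rTensor_eq (a := fun l => contract k (s l) 0)
      (b := fun _ => (0 : DivPow k V 0 →ₗ[k] PUnit.{u + 1})) ε fun w _ =>
        exists_contract_eq_of_card_lt hV hre hs 0 w S l hl hS
      fun q hq => by omega
  · funext J
    simp [koszulD_apply, hb]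

/-- Exactness of the strand at `∧^{r+1} U`. -/
lemma exists_koszulD_eq_of_splice_faceForm_eq_zero (S : Finset (Fin e))
    (f : Finset (Fin e) → DivPow k V 0 ⊗[k] TopDual k V r)
    (hf : SuppOn S (r + 1) f) (h : splice (faceForm k r s) f = 0) :
    ∃ g, SuppOn S (r + 2) g ∧ koszulD (contractTop k r s 0) g = f :=
  exists_koszulD_eq_of_splice_eq_zero (exists_koszulD_contractTop_zero_eq hV hre hs)
    (fun J hJ => (faceForm_bijective s hV hJ (hs J hJ)).1) (sum_faceForm_contract s hV) S f hf h

omit [Module.Finite k V] hV in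
lemma eq_zero_of_sum_smul_eq_zero (S : Finset (Fin e)) (hS : S.card ≤ r) (u : Fin e → k)
    (hu : ∀ l ∉ S, u l = 0) (h : ∑ l, u l • s l = 0) : u = 0 := by
  obtain ⟨R, hSR, hR⟩ := Finset.exists_superset_card_eq hS (by simpa using hre)
  have h0 : ∑ l : R, u l • s l = 0 := by
    rw [Finset.sum_coe_sort R fun l => u l • s l, ← h]
    refine Finset.sum_subset (Finset.subset_univ _) fun l _ hl => ?_
    rw [hu l fun h => hl (hSR h), zero_smul]
  have := Fintype.linearIndependent_iff.1 (hs R hR) (fun l => u l) h0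
  funext l
  by_cases hl : l ∈ R
  · exact this ⟨l, hl⟩
  · exact hu l fun h => hl (hSR h)

/-- Exactness of the strand at `U`. -/
lemma exists_splice_faceForm_eq (S : Finset (Fin e)) (u : Fin e → k)
    (hu : ∀ l ∉ S, u l = 0) (h : ∑ l, u l • s l = 0) :
    ∃ f, SuppOn S (r + 1) f ∧ splice (faceForm k r s) f = u :=
  exists_splice_eq (eq_zero_of_sum_smul_eq_zero hre hs)
    (fun J hJ => (faceForm_bijective s hV hJ (hs J hJ)).2) (sum_faceForm_smul s hV) S u hu h

end Strand


/-! ### Reduction to a single multidegree. -/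

section Coefficients

variable {k : Type*} [Field k] {σ : Type*} {M N : Type*} [AddCommGroup M] [Module k M]
  [AddCommGroup N] [Module k N]

/-- The coefficient of the monomial `x^ν`, as a map `Q ⊗ M → M`. -/
noncomputable def tensorCoeff (ν : σ →₀ ℕ) : MvPolynomial σ k ⊗[k] M →ₗ[k] M :=
  (TensorProduct.lid k M).toLinearMap ∘ₗ LinearMap.rTensor M (MvPolynomial.lcoeff k ν)

lemma tensorCoeff_tmul (ν : σ →₀ ℕ) (p : MvPolynomial σ k) (m : M) :
    tensorCoeff ν (p ⊗ₜ m) = p.coeff ν • m := by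
  simp [tensorCoeff]

lemma tensorCoeff_monomial_smul_baseChange (ν μ : σ →₀ ℕ) (c : k) (f : M →ₗ[k] N)
    (y : MvPolynomial σ k ⊗[k] M) :
    tensorCoeff ν (MvPolynomial.monomial μ c • f.baseChange (MvPolynomial σ k) y) =
      if μ ≤ ν then c • f (tensorCoeff (ν - μ) y) else 0 := by
  classical
  induction y using TensorProduct.induction_on with
  | zero => simp
  | add x y hx hy =>
    rw [map_add, smul_add, map_add, hx, hy]
    split_ifs
    · rw [map_add, map_add, smul_add]
    · rw [add_zero]
  | tmul p m =>
    rw [LinearMap.baseChange_tmul, TensorProduct.smul_tmul', tensorCoeff_tmul, smul_eq_mul,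
      MvPolynomial.coeff_monomial_mul', tensorCoeff_tmul]
    split_ifs
    · rw [map_smul, mul_smul]
    · rw [zero_smul]

variable {ι : Type*} (δ : ι → σ →₀ ℕ)

open Classical in
/-- The component of multidegree `a` of an element of `⊕ᵢ Q(-δᵢ) ⊗ M`. -/
noncomputable def strand (a : σ →₀ ℕ) : (ι → MvPolynomial σ k ⊗[k] M) →ₗ[k] (ι → M) :=
  LinearMap.pi fun i => if δ i ≤ a then tensorCoeff (a - δ i) ∘ₗ LinearMap.proj i else 0

open Classical in
/-- The inclusion of the component of multidegree `a`. -/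
noncomputable def unstrand (a : σ →₀ ℕ) (m : ι → M) : ι → MvPolynomial σ k ⊗[k] M :=
  fun i => if δ i ≤ a then MvPolynomial.monomial (a - δ i) 1 ⊗ₜ m i else 0

open Classical in
lemma strand_apply (a : σ →₀ ℕ) (x : ι → MvPolynomial σ k ⊗[k] M) (i : ι) :
    strand δ a x i = if δ i ≤ a then tensorCoeff (a - δ i) (x i) else 0 := by
  simp only [strand, LinearMap.pi_apply]
  split_ifs <;> simp

lemma le_of_strand_ne_zero {a : σ →₀ ℕ} {x : ι → MvPolynomial σ k ⊗[k] M} {i : ι}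
    (h : strand δ a x i ≠ 0) : δ i ≤ a := by
  by_contra h'
  exact h (by rw [strand_apply, if_neg h'])

lemma unstrand_add (a : σ →₀ ℕ) (m m' : ι → M) :
    unstrand (k := k) δ a (m + m') = unstrand δ a m + unstrand δ a m' := by
  funext i
  simp only [unstrand, Pi.add_apply]
  split_ifs
  · rw [TensorProduct.tmul_add]
  · rw [add_zero]

lemma unstrand_zero (a : σ →₀ ℕ) : unstrand (k := k) δ a (0 : ι → M) = 0 := by
  funext i
  simp [unstrand]

lemma strand_unstrand_self {a : σ →₀ ℕ} {m : ι → M} (hm : ∀ i, m i ≠ 0 → δ i ≤ a) :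
    strand (k := k) δ a (unstrand δ a m) = m := by
  classical
  funext i
  rw [strand_apply, unstrand]
  split_ifs with h
  · rw [tensorCoeff_tmul, MvPolynomial.coeff_monomial, if_pos rfl, one_smul]
  · by_contra h'
    exact h (hm i fun h'' => h' h''.symm)

lemma strand_unstrand_of_ne {a b : σ →₀ ℕ} (hab : a ≠ b) (m : ι → M) :
    strand (k := k) δ b (unstrand δ a m) = 0 := by
  classical
  funext i
  rw [strand_apply, unstrand]
  split_ifs with h h'
  · rw [tensorCoeff_tmul, MvPolynomial.coeff_monomial, if_neg, zero_smul, Pi.zero_apply]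
    intro h''
    exact hab (by rw [← tsub_add_cancel_of_le h, ← tsub_add_cancel_of_le h', h''])
  · rw [map_zero]; rfl
  · rfl

/-- Asking for all `F ⊇ F₀` makes the property additive in `x`, which reduces it to one monomial
tensor in one coordinate. -/
lemma exists_sum_unstrand_eq [Finite ι] (x : ι → MvPolynomial σ k ⊗[k] M) :
    ∃ F₀ : Finset (σ →₀ ℕ), ∀ F, F₀ ⊆ F → ∑ a ∈ F, unstrand δ a (strand δ a x) = x := by
  classical
  cases nonempty_fintype ι
  have hadd : ∀ x y : ι → MvPolynomial σ k ⊗[k] M,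
      (∃ F₀ : Finset (σ →₀ ℕ), ∀ F, F₀ ⊆ F → ∑ a ∈ F, unstrand δ a (strand δ a x) = x) →
      (∃ F₀ : Finset (σ →₀ ℕ), ∀ F, F₀ ⊆ F → ∑ a ∈ F, unstrand δ a (strand δ a y) = y) →
      ∃ F₀ : Finset (σ →₀ ℕ), ∀ F, F₀ ⊆ F →
        ∑ a ∈ F, unstrand δ a (strand δ a (x + y)) = x + y := by
    rintro x y ⟨F₁, h₁⟩ ⟨F₂, h₂⟩
    refine ⟨F₁ ∪ F₂, fun F hF => ?_⟩
    simp only [map_add, unstrand_add, Finset.sum_add_distrib]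
    rw [h₁ F (Finset.union_subset_left hF), h₂ F (Finset.union_subset_right hF)]
  have h0 : ∃ F₀ : Finset (σ →₀ ℕ), ∀ F, F₀ ⊆ F → ∑ a ∈ F, unstrand (k := k) δ a
      (strand δ a (0 : ι → MvPolynomial σ k ⊗[k] M)) = 0 :=
    ⟨∅, fun F _ => by simp only [map_zero, unstrand_zero, Finset.sum_const_zero]⟩
  rw [← Finset.univ_sum_single x]
  refine Finset.sum_induction _ (fun x : ι → MvPolynomial σ k ⊗[k] M =>
    ∃ F₀ : Finset (σ →₀ ℕ), ∀ F, F₀ ⊆ F → ∑ a ∈ F, unstrand δ a (strand δ a x) = x) hadd h0 fun i _ => ?_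
  induction x i using TensorProduct.induction_on with
  | zero => rw [Pi.single_zero]; exact h0
  | add y z hy hz => rw [Pi.single_add]; exact hadd _ _ hy hz
  | tmul p m =>
    induction p using MvPolynomial.induction_on' with
    | add p q hp hq => rw [TensorProduct.add_tmul, Pi.single_add]; exact hadd _ _ hp hq
    | monomial ν c =>
      refine ⟨{ν + δ i}, fun F hF => ?_⟩
      have : Pi.single i (MvPolynomial.monomial ν c ⊗ₜ m) =
          unstrand (k := k) δ (ν + δ i) (Pi.single i (c • m)) := by
        funext j
        by_cases hj : j = i
        · subst hj
          rw [Pi.single_eq_same, unstrand, if_pos le_add_self, add_tsub_cancel_right,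
            Pi.single_eq_same, TensorProduct.tmul_smul, TensorProduct.smul_tmul',
            MvPolynomial.smul_monomial, smul_eq_mul, mul_one]
        · rw [Pi.single_eq_of_ne hj, unstrand, Pi.single_eq_of_ne hj]
          simp
      rw [this, Finset.sum_eq_single_of_mem (ν + δ i) (hF (Finset.mem_singleton_self _)),
        strand_unstrand_self]
      · intro j hj
        by_cases hj' : j = i
        · rw [hj']; exact le_add_self
        · rw [Pi.single_eq_of_ne hj'] at hj
          exact absurd rfl hj
      · intro b _ hb
        rw [strand_unstrand_of_ne δ hb.symm, unstrand_zero]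

lemma eq_of_strand_eq [Finite ι] {x y : ι → MvPolynomial σ k ⊗[k] M}
    (h : ∀ a, strand δ a x = strand δ a y) : x = y := by
  rw [← sub_eq_zero]
  obtain ⟨F, hF⟩ := exists_sum_unstrand_eq δ (x - y)
  rw [← hF F subset_rfl]
  refine Finset.sum_eq_zero fun a _ => ?_
  rw [map_sub, h, sub_self, unstrand_zero]

open Classical in
/-- A monomial matrix entry acts on components of multidegree `a` by its coefficient. -/
lemma strand_monomial_smul_baseChange {δ₀ δ₁ : σ →₀ ℕ} {c : k} (h : c ≠ 0 → δ₀ ≤ δ₁)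
    (f : M →ₗ[k] N) (y : MvPolynomial σ k ⊗[k] M) (a : σ →₀ ℕ) :
    (if δ₀ ≤ a then tensorCoeff (a - δ₀)
      (MvPolynomial.monomial (δ₁ - δ₀) c • f.baseChange (MvPolynomial σ k) y) else 0) =
      c • f (if δ₁ ≤ a then tensorCoeff (a - δ₁) y else 0) := by
  by_cases hc : c = 0
  · simp [hc]
  have h := h hc
  by_cases h₁ : δ₁ ≤ a
  · rw [if_pos (h.trans h₁), if_pos h₁, tensorCoeff_monomial_smul_baseChange,
      if_pos (tsub_le_tsub_right h₁ _), tsub_tsub_tsub_cancel_right h]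
  · rw [if_neg h₁, map_zero, smul_zero]
    split_ifs with h₀
    · rw [tensorCoeff_monomial_smul_baseChange, if_neg]
      intro h'
      exact h₁ ((tsub_le_tsub_iff_right h₀).1 h')
    · rfl

-- The degree inequality is needed only for nonzero coefficients: for a zero entry the truncated
-- difference of degrees is meaningless but harmless.
open Classical in
lemma strand_sum_monomial_smul {Λ : Type*} [Fintype Λ] (i : Λ → ι) {δ₀ : σ →₀ ℕ} (c : Λ → k)
    (h : ∀ t, c t ≠ 0 → δ₀ ≤ δ (i t)) (f : Λ → M →ₗ[k] N) (x : ι → MvPolynomial σ k ⊗[k] M)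
    (a : σ →₀ ℕ) :
    (if δ₀ ≤ a then tensorCoeff (a - δ₀) (∑ t, MvPolynomial.monomial (δ (i t) - δ₀) (c t) •
      (f t).baseChange (MvPolynomial σ k) (x (i t))) else 0) =
      ∑ t, c t • f t (strand δ a x (i t)) := by
  have h1 : ∀ t, c t • f t (strand δ a x (i t)) = if δ₀ ≤ a then tensorCoeff (a - δ₀)
      (MvPolynomial.monomial (δ (i t) - δ₀) (c t) •
        (f t).baseChange (MvPolynomial σ k) (x (i t))) else 0 := fun t => by
    rw [strand_monomial_smul_baseChange (h t), strand_apply]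
  rw [Finset.sum_congr rfl fun t _ => h1 t]
  split_ifs
  · rw [map_sum]
  · rw [Finset.sum_const_zero]

/-- A sequence of multigraded maps is exact if it is exact in each multidegree. -/
lemma exact_of_strand {ι₀ ι₁ ι₂ : Type*} [Finite ι₀] [Finite ι₁] {M₀ M₁ M₂ : Type*}
    [AddCommGroup M₀] [Module k M₀] [AddCommGroup M₁] [Module k M₁] [AddCommGroup M₂] [Module k M₂]
    (δ₀ : ι₀ → σ →₀ ℕ) (δ₁ : ι₁ → σ →₀ ℕ) (δ₂ : ι₂ → σ →₀ ℕ)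
    (d₁ : (ι₁ → MvPolynomial σ k ⊗[k] M₁) →ₗ[MvPolynomial σ k] (ι₀ → MvPolynomial σ k ⊗[k] M₀))
    (d₂ : (ι₂ → MvPolynomial σ k ⊗[k] M₂) →ₗ[MvPolynomial σ k] (ι₁ → MvPolynomial σ k ⊗[k] M₁))
    (D₁ : (ι₁ → M₁) → (ι₀ → M₀)) (D₂ : (ι₂ → M₂) → (ι₁ → M₁)) (hD₂ : D₂ 0 = 0)
    (h₁ : ∀ a x, strand δ₀ a (d₁ x) = D₁ (strand δ₁ a x))
    (h₂ : ∀ a x, strand δ₁ a (d₂ x) = D₂ (strand δ₂ a x))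
    (h0 : ∀ f, D₁ (D₂ f) = 0)
    (hex : ∀ (a : σ →₀ ℕ) (f : ι₁ → M₁), (∀ i, f i ≠ 0 → δ₁ i ≤ a) → D₁ f = 0 →
      ∃ g : ι₂ → M₂, (∀ i, g i ≠ 0 → δ₂ i ≤ a) ∧ D₂ g = f) :
    Function.Exact d₂ d₁ := by
  intro x
  constructor
  · intro hx
    obtain ⟨F, hF⟩ := exists_sum_unstrand_eq δ₁ x
    rw [← hF F subset_rfl]
    refine (LinearMap.range d₂).sum_mem fun a _ => ?_
    obtain ⟨g, hg, hg'⟩ := hex a (strand δ₁ a x) (fun i => le_of_strand_ne_zero δ₁)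
      (by rw [← h₁, hx, map_zero])
    -- The preimage found over `k` is placed in multidegree `a`; the degree bound on `g` ensures
    -- that nothing is truncated.
    refine ⟨unstrand δ₂ a g, eq_of_strand_eq δ₁ fun b => ?_⟩
    rw [h₂]
    by_cases hab : a = b
    · subst hab
      rw [strand_unstrand_self δ₂ hg, hg', strand_unstrand_self δ₁]
      exact fun i => le_of_strand_ne_zero δ₁
    · rw [strand_unstrand_of_ne δ₂ hab, strand_unstrand_of_ne δ₁ hab, hD₂]
  · rintro ⟨y, rfl⟩
    refine eq_of_strand_eq δ₀ fun a => ?_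
    rw [h₁, h₂, h0, map_zero]

end Coefficients

/-! ### From families on faces of fixed size to families on all subsets. -/

section Faces

variable {k : Type*} [Field k] {e : ℕ} {A B : Type*} [AddCommGroup A] [Module k A]
  [AddCommGroup B] [Module k B]

/-- Extension by zero of a family indexed by faces. -/
def extend {m : ℕ} (f : Face e m → A) : Finset (Fin e) → A :=
  fun J => if h : J.card = m then f ⟨J, h⟩ else 0

lemma extend_coe {m : ℕ} (f : Face e m → A) (J : Face e m) : extend f J.1 = f J := by
  simp [extend, J.2]

lemma extend_zero (m : ℕ) : extend (0 : Face e m → A) = 0 := by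
  funext J
  simp [extend]

lemma extend_injective {m : ℕ} : Function.Injective (extend : (Face e m → A) → _) := by
  intro f g h
  funext J
  rw [← extend_coe f, h, extend_coe]

lemma SuppOn.extend_restrict {S : Finset (Fin e)} {m : ℕ} {f : Finset (Fin e) → A}
    (hf : SuppOn S m f) : extend (fun J : Face e m => f J.1) = f := by
  funext J
  unfold extend
  split_ifs with h
  · rfl
  · by_contra h'
    exact h (hf J fun h'' => h' h''.symm).2

lemma suppOn_extend {S : Finset (Fin e)} {m : ℕ} {f : Face e m → A}
    (hf : ∀ J, f J ≠ 0 → J.1 ⊆ S) : SuppOn S m (extend f) := by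
  intro J hJ
  unfold extend at hJ
  split_ifs at hJ with h
  · exact ⟨hf _ hJ, h⟩
  · exact absurd rfl hJ

/-- The differential `koszulD` on families indexed by faces. -/
def faceD (a : Fin e → A →ₗ[k] B) {m : ℕ} (f : Face e (m + 1) → A) : Face e m → B :=
  fun J => ∑ l : {l : Fin e // l ∉ J.1}, sgn l.1 J.1 • a l (f (J.insert l))

lemma extend_faceD (a : Fin e → A →ₗ[k] B) {m : ℕ} (f : Face e (m + 1) → A) :
    extend (faceD a f) = koszulD a (extend f) := by
  have hs : SuppOn Finset.univ m (koszulD a (extend f)) :=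
    (suppOn_extend fun J _ => Finset.subset_univ _).koszulD a
  rw [← hs.extend_restrict]
  congr 1
  funext J
  rw [koszulD_apply, faceD]
  rw [Finset.sum_subtype (J.1)ᶜ (p := fun l => l ∉ J.1) (by simp)]
  refine Finset.sum_congr rfl fun l _ => ?_
  congr 2
  exact (extend_coe f (J.insert l)).symm

/-- The map `splice` on families indexed by faces. -/
def faceSplice (η : Finset (Fin e) → B →ₗ[k] k) {m : ℕ} (f : Face e (m + 1) → B) : Fin e → k :=
  fun l => ∑ I : Face e (m + 1),
    if l ∈ I.1 then sgn l (I.1.erase l) • η (I.1.erase l) (f I) else 0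

lemma faceSplice_eq (η : Finset (Fin e) → B →ₗ[k] k) {m : ℕ} (f : Face e (m + 1) → B) :
    faceSplice η f = splice η (extend f) := by
  funext l
  have h1 : ∀ I : Finset (Fin e), (if l ∈ I then sgn l (I.erase l) • η (I.erase l) (extend f I)
      else 0) ≠ 0 → I.card = m + 1 := by
    intro I hI
    by_contra h
    exact hI (by simp [extend, h])
  have h2 : faceSplice η f l = ∑ I : Finset (Fin e), if l ∈ I then
      sgn l (I.erase l) • η (I.erase l) (extend f I) else 0 := by
    rw [← Finset.sum_filter_of_ne (p := fun I => I.card = m + 1) fun I _ => h1 I,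
      Finset.sum_subtype _ (p := fun I : Finset (Fin e) => I.card = m + 1) (by simp)]
    refine Finset.sum_congr rfl fun I _ => ?_
    rw [extend_coe]
  rw [h2, splice_apply, ← Finset.sum_filter]
  refine (Finset.sum_nbij' (fun J => insert l J) (fun I => I.erase l) ?_ ?_ ?_ ?_ ?_).symm <;>
    intro J hJ <;> simp_all

variable {σ : Type*} (δ : Finset (Fin e) → σ →₀ ℕ) (hδ : Monotone δ)
include hδ

lemma strand_eq_faceD (a : Fin e → A →ₗ[k] B) {m : ℕ}
    (x : Face e (m + 1) → MvPolynomial σ k ⊗[k] A) (y : Face e m → MvPolynomial σ k ⊗[k] B)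
    (h : ∀ J, y J = ∑ l : {l : Fin e // l ∉ J.1},
      MvPolynomial.monomial (δ (J.insert l).1 - δ J.1) (sgn l.1 J.1 : k) •
        (a l).baseChange (MvPolynomial σ k) (x (J.insert l))) (b : σ →₀ ℕ) :
    strand (fun J : Face e m => δ J.1) b y =
      faceD a (strand (fun J : Face e (m + 1) => δ J.1) b x) := by
  classical
  funext J
  rw [strand_apply, h, strand_sum_monomial_smul (fun I : Face e (m + 1) => δ I.1)
    (fun l : {l : Fin e // l ∉ J.1} => J.insert l) _
    (fun _ _ => hδ (Finset.subset_insert _ _)) (fun l => a l)]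
  exact Finset.sum_congr rfl fun l _ => by rw [Int.cast_smul_eq_zsmul]

lemma strand_eq_faceSplice (η : Finset (Fin e) → B →ₗ[k] k) {m : ℕ}
    (x : Face e (m + 1) → MvPolynomial σ k ⊗[k] B) (y : Fin e → MvPolynomial σ k ⊗[k] k)
    (h : ∀ l, y l = ∑ I : Face e (m + 1), if l ∈ I.1 then
        MvPolynomial.monomial (δ I.1 - δ {l}) (sgn l (I.1.erase l) : k) •
        (η (I.1.erase l)).baseChange (MvPolynomial σ k) (x I) else 0) (b : σ →₀ ℕ) :
    strand (fun l => δ {l}) b y = faceSplice η (strand (fun I : Face e (m + 1) => δ I.1) b x) := by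
  classical
  funext l
  -- Faces missing `l` are kept with coefficient zero, so that every face contributes a monomial
  -- entry.
  have h' : y l = ∑ I : Face e (m + 1), MvPolynomial.monomial (δ I.1 - δ {l})
      (if l ∈ I.1 then (sgn l (I.1.erase l) : k) else 0) •
        (η (I.1.erase l)).baseChange (MvPolynomial σ k) (x I) := by
    rw [h]
    exact Finset.sum_congr rfl fun I _ => by split_ifs <;> simp
  rw [strand_apply, h', strand_sum_monomial_smul (fun I : Face e (m + 1) => δ I.1)
    (fun I : Face e (m + 1) => I) _ ?_
    (fun I => η (I.1.erase l))]
  · refine Finset.sum_congr rfl fun I _ => ?_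
    by_cases hl : l ∈ I.1
    · rw [if_pos hl, if_pos hl, Int.cast_smul_eq_zsmul]
    · rw [if_neg hl, if_neg hl, zero_smul]
  · intro I hI
    refine hδ (Finset.singleton_subset_iff.2 ?_)
    by_contra hl
    exact hI (if_neg hl)

end Faces


/-! ### Strands of the Taylor differentials. -/

section Taylor

variable {k : Type u} [Field k] {n e g : ℕ} {E G : Type u}
  [AddCommGroup E] [Module (MvPolynomial (Fin n) k) E]
  [AddCommGroup G] [Module (MvPolynomial (Fin n) k) G]
  (bE : HomogeneousBasis k n e E) (bG : HomogeneousBasis k n g G)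
  (φ : E →ₗ[MvPolynomial (Fin n) k] G)

/-- Coordinates with respect to a homogeneous basis, as elements of `Q ⊗ k`. -/
noncomputable def HomogeneousBasis.coords :
    E ≃ₗ[MvPolynomial (Fin n) k] (Fin e → MvPolynomial (Fin n) k ⊗[k] k) :=
  bE.basis.equivFun ≪≫ₗ LinearEquiv.piCongrRight fun _ =>
    (TensorProduct.AlgebraTensorModule.rid k (MvPolynomial (Fin n) k) _).symm

lemma HomogeneousBasis.coords_apply (x : E) (l : Fin e) :
    bE.coords x l = bE.basis.repr x l ⊗ₜ 1 := by
  simp [HomogeneousBasis.coords]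

lemma HomogeneousBasis.coords_smulRight {T : Type*} [AddCommGroup T]
    [Module (MvPolynomial (Fin n) k) T] (F : T →ₗ[MvPolynomial (Fin n) k] MvPolynomial (Fin n) k)
    (x : T) (m l : Fin e) :
    bE.coords (F.smulRight (bE.basis m) x) l = if m = l then F x ⊗ₜ 1 else 0 := by
  rw [bE.coords_apply, LinearMap.smulRight_apply, map_smul, Finsupp.smul_apply,
    Module.Basis.repr_self, Finsupp.single_apply]
  split_ifs
  · rw [smul_eq_mul, mul_one]
  · rw [smul_zero, TensorProduct.zero_tmul]

lemma HomogeneousBasis.isHomogeneous_basis (l : Fin e) :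
    bE.IsHomogeneous (bE.deg l) (bE.basis l) := by
  classical
  intro j ν hν
  rw [Module.Basis.repr_self, Finsupp.single_apply] at hν
  split_ifs at hν with h
  · subst h
    rw [MvPolynomial.mem_support_iff, MvPolynomial.coeff_one] at hν
    have : 0 = ν := by by_contra h; exact hν (if_neg h)
    rw [← this, zero_add]
  · simp at hν

variable {bE bG φ}

/-- The entries of the matrix of a multigraded morphism are monomials. -/
lemma IsMultigraded.repr_basis (hφ : IsMultigraded bE bG φ) (i : Fin g) (l : Fin e) :
    bG.basis.repr (φ (bE.basis l)) i =
      MvPolynomial.monomial (bE.deg l - bG.deg i) (coeffMatrix bE bG φ i l) ∧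
    (coeffMatrix bE bG φ i l ≠ 0 → bG.deg i ≤ bE.deg l) := by
  have h := hφ _ _ (bE.isHomogeneous_basis l) i
  have hc : coeffMatrix bE bG φ i l =
      MvPolynomial.eval (fun _ => 1) (bG.basis.repr (φ (bE.basis l)) i) := by
    rw [coeffMatrix, Matrix.map_apply, LinearMap.toMatrix_apply]
  rw [hc]
  generalize bG.basis.repr (φ (bE.basis l)) i = p at h ⊢
  -- Homogeneity leaves only one possible exponent, and evaluation at `(1, …, 1)` then reads off its
  -- coefficient.
  have hp : p = MvPolynomial.monomial (bE.deg l - bG.deg i)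
      (p.coeff (bE.deg l - bG.deg i)) := by
    classical
    ext ν
    rw [MvPolynomial.coeff_monomial]
    split_ifs with hν
    · rw [hν]
    · by_contra h0
      have := h ν (MvPolynomial.mem_support_iff.2 h0)
      exact hν (by rw [← this, add_tsub_cancel_right])
  have he : MvPolynomial.eval (fun _ => (1 : k)) p = p.coeff (bE.deg l - bG.deg i) := by
    conv_lhs => rw [hp]
    simp [MvPolynomial.eval_monomial]
  rw [he]
  refine ⟨hp, fun h0 => ?_⟩
  rw [← h _ (MvPolynomial.mem_support_iff.2 h0)]
  exact le_add_self

lemma coeffMap_apply (u : Fin e → k) (i : Fin g) :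
    coeffMap bE bG φ u i = ∑ l, coeffMatrix bE bG φ i l * u l := rfl

lemma IsMultigraded.strand_coords (hφ : IsMultigraded bE bG φ) (a : Fin n →₀ ℕ) (x : E) :
    strand bG.deg a (bG.coords (φ x)) = coeffMap bE bG φ (strand bE.deg a (bE.coords x)) := by
  classical
  have hx : ∀ i, bG.coords (φ x) i = ∑ l, MvPolynomial.monomial (bE.deg l - bG.deg i)
      (coeffMatrix bE bG φ i l) • (LinearMap.id : k →ₗ[k] k).baseChange (MvPolynomial (Fin n) k)
        (bE.coords x l) := by
    intro i
    rw [bG.coords_apply]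
    conv_lhs => rw [← bE.basis.sum_repr x]
    rw [map_sum, map_sum, Finsupp.finsetSum_apply, TensorProduct.sum_tmul]
    refine Finset.sum_congr rfl fun l _ => ?_
    rw [map_smul, map_smul, Finsupp.smul_apply, (hφ.repr_basis i l).1, bE.coords_apply,
      LinearMap.baseChange_tmul, TensorProduct.smul_tmul', smul_eq_mul, smul_eq_mul, mul_comm,
      LinearMap.id_apply]
  funext i
  rw [strand_apply, hx, coeffMap_apply]
  rw [strand_sum_monomial_smul bE.deg (fun l => l) _ (fun l => (hφ.repr_basis i l).2)
    (fun _ => LinearMap.id)]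
  rfl

variable (bE bG φ)

/-- The degree of a face. -/
noncomputable abbrev faceDegree (m : ℕ) (I : Face e m) : Fin n →₀ ℕ := faceDeg bE I.1

/-- A join is at most `a` when each vertex degree is. The faces alive in multidegree `a` thus form a
full simplex, which makes an induction on vertex sets possible. -/
lemma faceDeg_le_iff (I : Finset (Fin e)) (a : Fin n →₀ ℕ) [DecidablePred fun l => bE.deg l ≤ a] :
    faceDeg bE I ≤ a ↔ I ⊆ Finset.univ.filter fun l => bE.deg l ≤ a := by
  simp [faceDeg, Finset.sup_le_iff, Finset.subset_iff]

lemma faceDeg_mono {I J : Finset (Fin e)} (h : I ⊆ J) : faceDeg bE I ≤ faceDeg bE J :=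
  Finset.sup_mono h

lemma faceDeg_singleton (l : Fin e) : faceDeg bE {l} = bE.deg l := Finset.sup_singleton

lemma strand_taylorHigher (p : ℕ) (a : Fin n →₀ ℕ) (x : HigherTaylor bE bG φ (p + 1)) :
    strand (faceDegree bE (rk φ + p + 1)) a (taylorHigher bE bG φ p x) =
      faceD (contractTop k (rk φ) (sBasis bE bG φ) p)
        (strand (faceDegree bE (rk φ + p + 1 + 1)) a x) :=
  strand_eq_faceD (faceDeg bE) (fun _ _ h => faceDeg_mono bE h)
    (contractTop k (rk φ) (sBasis bE bG φ) p) (m := rk φ + p + 1) x _ (fun J => by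
      simp only [taylorHigher, LinearMap.pi_apply, LinearMap.sum_apply, LinearMap.smul_apply]
      rfl) a

lemma taylorTwoComponent_tmul_one (I : Face e (rk φ + 0 + 1)) (l : {l : Fin e // l ∈ I.1})
    (y : MvPolynomial (Fin n) k ⊗[k]
      (DivPow k (imS bE bG φ) 0 ⊗[k] TopDual k (imS bE bG φ) (rk φ))) :
    taylorTwoComponent bE bG φ I l y ⊗ₜ[k] (1 : k) =
      MvPolynomial.monomial (faceDeg bE I.1 - bE.deg l.1) (sgn l.1 (I.1.erase l.1) : k) •
        (faceForm k (rk φ) (sBasis bE bG φ) (I.1.erase l.1)).baseChange (MvPolynomial (Fin n) k)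
          y := by
  have hc : (I.1.erase l.1).card = rk φ := by rw [Finset.card_erase_of_mem l.2, I.2]; rfl
  have hrid : ∀ z : MvPolynomial (Fin n) k ⊗[k] k,
      (TensorProduct.AlgebraTensorModule.rid k (MvPolynomial (Fin n) k)
        (MvPolynomial (Fin n) k) z) ⊗ₜ[k] (1 : k) = z := fun z =>
    (TensorProduct.AlgebraTensorModule.rid k (MvPolynomial (Fin n) k)
        (MvPolynomial (Fin n) k)).symm_apply_apply z
  rw [taylorTwoComponent, LinearMap.smul_apply, ← TensorProduct.smul_tmul',
    LinearMap.comp_apply, LinearEquiv.coe_coe, hrid, faceForm, dif_pos hc]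

set_option maxHeartbeats 400000 in
lemma strand_taylorTwo (a : Fin n →₀ ℕ) (x : HigherTaylor bE bG φ 0) :
    strand bE.deg a (bE.coords (taylorTwo bE bG φ x)) =
      faceSplice (faceForm k (rk φ) (sBasis bE bG φ))
        (strand (faceDegree bE (rk φ + 0 + 1)) a x) := by
  classical
  have hδ : bE.deg = fun l => faceDeg bE {l} := funext fun l => (faceDeg_singleton bE l).symm
  rw [hδ]
  refine strand_eq_faceSplice (faceDeg bE) (fun _ _ h => faceDeg_mono bE h) _ x _ (fun l => ?_) a
  rw [taylorTwo, LinearMap.sum_apply, map_sum, Finset.sum_apply]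
  refine Finset.sum_congr rfl fun I _ => ?_
  rw [LinearMap.sum_apply, map_sum, Finset.sum_apply]
  have hm : ∀ m : {l : Fin e // l ∈ I.1}, bE.coords (((taylorTwoComponent bE bG φ I m ∘ₗ
      LinearMap.proj I).smulRight (bE.basis m.1)) x) l =
      if m.1 = l then (taylorTwoComponent bE bG φ I m (x I)) ⊗ₜ 1 else 0 := fun m =>
    bE.coords_smulRight _ x m.1 l
  rw [Finset.sum_congr rfl fun m _ => hm m]
  by_cases hl : l ∈ I.1
  · rw [if_pos hl, Finset.sum_eq_single_of_mem ⟨l, hl⟩ (Finset.mem_univ _), if_pos rfl,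
      taylorTwoComponent_tmul_one, faceDeg_singleton]
    intro m _ hm
    rw [if_neg]
    intro h
    exact hm (Subtype.ext h)
  · rw [if_neg hl]
    refine Finset.sum_eq_zero fun m _ => ?_
    rw [if_neg]
    rintro rfl
    exact hl m.2

/-- Relations among the columns in `W` are relations among vectors of `V`, where the determinants
live. -/
lemma coeffMap_eq_zero_iff (u : Fin e → k) :
    coeffMap bE bG φ u = 0 ↔ ∑ l, u l • sBasis bE bG φ l = 0 := by
  have : ((∑ l, u l • sBasis bE bG φ l : imS bE bG φ) : Fin g → k) = coeffMap bE bG φ u := by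
    conv_rhs => rw [← Finset.univ_sum_single u]
    rw [map_sum, Submodule.coe_sum]
    refine Finset.sum_congr rfl fun l _ => ?_
    rw [Submodule.coe_smul, sBasis, LinearMap.codRestrict_apply, ← map_smul, ← Pi.single_smul,
      smul_eq_mul, mul_one]
  rw [← this, Submodule.coe_eq_zero]

end Taylor


/-! ### The rank of `φ`, and exactness over `Q`. -/

section Resolution

variable {k : Type u} [Field k] {n e g : ℕ} {E G : Type u}
  [AddCommGroup E] [Module (MvPolynomial (Fin n) k) E]
  [AddCommGroup G] [Module (MvPolynomial (Fin n) k) G]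
  {bE : HomogeneousBasis k n e E} {bG : HomogeneousBasis k n g G}
  {φ : E →ₗ[MvPolynomial (Fin n) k] G}

lemma HomogeneousBasis.finite (bE : HomogeneousBasis k n e E) :
    Module.Finite (MvPolynomial (Fin n) k) E :=
  Module.Finite.of_basis bE.basis

lemma rk_le (bE : HomogeneousBasis k n e E) : rk φ ≤ e := by
  have := bE.finite
  calc rk φ ≤ Module.finrank (MvPolynomial (Fin n) k) E := LinearMap.finrank_range_le φ
    _ = e := by rw [Module.finrank_eq_card_basis bE.basis, Fintype.card_fin]

lemma coe_sBasis (l : Fin e) (i : Fin g) :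
    (sBasis bE bG φ l : Fin g → k) i = coeffMatrix bE bG φ i l := by
  change coeffMap bE bG φ (Pi.single l 1) i = _
  rw [coeffMap, Matrix.mulVecLin_apply, Matrix.mulVec_single_one, Matrix.col_apply]

lemma HasUniformRank.linearIndependent (hu : HasUniformRank bE bG φ) (J : Finset (Fin e))
    (hJ : J.card = rk φ) : LinearIndependent k fun l : J => sBasis bE bG φ l := by
  have h := hu (J.orderEmbOfFin hJ)
  rw [Matrix.rank_eq_finrank_span_cols] at h
  have h1 := linearIndependent_iff_card_eq_finrank_span.2
    (show Fintype.card (Fin (rk φ)) = _ by rw [Fintype.card_fin]; exact h.symm)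
  have h2 : LinearIndependent k fun t => sBasis bE bG φ (J.orderEmbOfFin hJ t) := by
    apply LinearIndependent.of_comp (imS bE bG φ).subtype
    have he : (imS bE bG φ).subtype ∘ (fun t => sBasis bE bG φ (J.orderEmbOfFin hJ t)) =
        ((coeffMatrix bE bG φ).submatrix id (J.orderEmbOfFin hJ)).col := by
      funext t i
      exact coe_sBasis _ _
    rw [he]
    exact h1
  rw [← linearIndependent_equiv (J.orderIsoOfFin hJ).toEquiv]
  exact h2

lemma span_sBasis : Submodule.span k (Set.range (sBasis bE bG φ)) = ⊤ := by
  rw [eq_top_iff]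
  rintro ⟨_, u, rfl⟩ _
  have : (⟨coeffMap bE bG φ u, u, rfl⟩ : imS bE bG φ) = ∑ l, u l • sBasis bE bG φ l := by
    ext i
    simp only [Submodule.coe_sum, Submodule.coe_smul, Finset.sum_apply, Pi.smul_apply, coe_sBasis,
      coeffMap_apply, smul_eq_mul, mul_comm]
  rw [this]
  exact Submodule.sum_mem _ fun l _ =>
    Submodule.smul_mem _ _ (Submodule.subset_span (Set.mem_range_self l))

/-- Columns of the coefficient matrix that are independent over `k` give independent columns of
`φ`. -/
lemma IsMultigraded.linearIndependent (hφ : IsMultigraded bE bG φ) {κ : Type*} [Fintype κ]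
    {a : κ → Fin e} (ha : Function.Injective a)
    (h : LinearIndependent k (sBasis bE bG φ ∘ a)) :
    LinearIndependent (MvPolynomial (Fin n) k) fun t => φ (bE.basis (a t)) := by
  rw [Fintype.linearIndependent_iff]
  intro y hy
  have hx0 : φ (∑ t, y t • bE.basis (a t)) = 0 := by simpa using hy
  suffices H : ∑ t, y t • bE.basis (a t) = 0 from
    Fintype.linearIndependent_iff.1 (bE.basis.linearIndependent.comp a ha) y H
  rw [← LinearEquiv.map_eq_zero_iff bE.coords]
  refine eq_of_strand_eq bE.deg fun b => ?_
  rw [map_zero]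
  -- Each multidegree of a `Q`-linear relation is a `k`-linear relation among the chosen columns of
  -- the coefficient matrix, hence trivial.
  have hu := hφ.strand_coords b (∑ t, y t • bE.basis (a t))
  rw [hx0, map_zero, map_zero] at hu
  have hout : ∀ l, l ∉ Set.range a → bE.coords (∑ t, y t • bE.basis (a t)) l = 0 := by
    intro l hl
    rw [bE.coords_apply, map_sum, Finsupp.finsetSum_apply, Finset.sum_eq_zero,
      TensorProduct.zero_tmul]
    intro t _
    rw [map_smul, Finsupp.smul_apply, Module.Basis.repr_self, Finsupp.single_apply, if_neg,
      smul_zero]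
    exact fun h => hl ⟨t, h⟩
  generalize bE.coords (∑ t, y t • bE.basis (a t)) = x at hu hout ⊢
  have h0 := (coeffMap_eq_zero_iff bE bG φ _).1 hu.symm
  have hz : ∀ l, l ∉ Set.range a → strand bE.deg b x l = 0 := by
    classical
    intro l hl
    rw [strand_apply, hout l hl, map_zero, ite_self]
  have h1 : ∑ t, strand bE.deg b x (a t) • sBasis bE bG φ (a t) = 0 := by
    rw [← h0, ← Finset.sum_image (f := fun l => strand bE.deg b x l • sBasis bE bG φ l)
      (fun x _ y _ hxy => ha hxy)]
    refine Finset.sum_subset (Finset.subset_univ _) fun l _ hl => ?_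
    rw [hz l (by simpa using hl), zero_smul]
  have h2 := Fintype.linearIndependent_iff.1 h _ h1
  funext l
  by_cases hl : l ∈ Set.range a
  · obtain ⟨t, rfl⟩ := hl
    exact h2 t
  · exact hz l hl

/-- The rank of `φ` is taken over `Q` and the dimension of `V` over `k`. Independent columns over
`k` remain independent over `Q`, which bounds the dimension above; uniform rank provides `rk φ`
independent columns, since `rk φ ≤ e`. -/
lemma finrank_imS (hφ : IsMultigraded bE bG φ) (hu : HasUniformRank bE bG φ) :
    Module.finrank k (imS bE bG φ) = rk φ := by
  apply le_antisymm
  · obtain ⟨κ, a, ha, hspan, hli⟩ := exists_linearIndependent' k (sBasis bE bG φ)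
    have : Finite κ := Finite.of_injective a ha
    have := Fintype.ofFinite κ
    have hcard : Module.finrank k (imS bE bG φ) = Fintype.card κ :=
      Module.finrank_eq_card_basis (Module.Basis.mk hli (by rw [hspan, span_sBasis]))
    have hli' : LinearIndependent (MvPolynomial (Fin n) k)
        fun t => (⟨φ (bE.basis (a t)), LinearMap.mem_range_self _ _⟩ : LinearMap.range φ) :=
      LinearIndependent.of_comp (LinearMap.range φ).subtype (hφ.linearIndependent ha hli)
    have := bE.finite
    rw [hcard]
    exact hli'.fintype_card_le_finrank
  · obtain ⟨J, _, hJ⟩ := Finset.exists_subset_card_eq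
      (show rk φ ≤ (Finset.univ : Finset (Fin e)).card by simpa using rk_le bE)
    have := (hu.linearIndependent J hJ).fintype_card_le_finrank
    simpa [hJ] using this

lemma exact_taylorTwo (hφ : IsMultigraded bE bG φ) (hu : HasUniformRank bE bG φ) :
    Function.Exact (taylorTwo bE bG φ) φ := by
  classical
  have hV := finrank_imS hφ hu
  have h : Function.Exact (bE.coords.toLinearMap ∘ₗ taylorTwo bE bG φ)
      (bG.coords.toLinearMap ∘ₗ φ ∘ₗ bE.coords.symm.toLinearMap) := by
    refine exact_of_strand bG.deg bE.deg (faceDegree bE (rk φ + 0 + 1)) _ _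
      (coeffMap bE bG φ) (faceSplice (faceForm k (rk φ) (sBasis bE bG φ))) ?_ ?_ ?_ ?_ ?_
    · rw [faceSplice_eq, extend_zero, map_zero]
    · intro a x
      have := hφ.strand_coords a (bE.coords.symm x)
      rwa [LinearEquiv.apply_symm_apply] at this
    · exact fun a x => strand_taylorTwo bE bG φ a x
    · intro f
      rw [faceSplice_eq, coeffMap_eq_zero_iff]
      exact sum_splice_smul (sum_faceForm_smul _ hV) _
    · intro a f hf h0
      -- The strand is taken on the vertices of degree at most `a`; keeping the support of the
      -- preimage inside this set is what respects the multidegree.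
      obtain ⟨F, hF, hF'⟩ := exists_splice_faceForm_eq hV (rk_le bE) hu.linearIndependent
        (Finset.univ.filter fun l => bE.deg l ≤ a) f
        (fun l hl => by by_contra h; exact hl (by simpa using hf l h))
        ((coeffMap_eq_zero_iff bE bG φ f).1 h0)
      refine ⟨fun J => F J.1, fun J hJ => (faceDeg_le_iff bE _ _).2 (hF _ hJ).1, ?_⟩
      rw [faceSplice_eq, hF.extend_restrict, hF']
  intro x
  have := h (bE.coords x)
  simpa using this

lemma exact_taylorHigher_zero (hφ : IsMultigraded bE bG φ) (hu : HasUniformRank bE bG φ) :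
    Function.Exact (taylorHigher bE bG φ 0) (taylorTwo bE bG φ) := by
  classical
  have hV := finrank_imS hφ hu
  have h : Function.Exact (taylorHigher bE bG φ 0)
      (bE.coords.toLinearMap ∘ₗ taylorTwo bE bG φ) := by
    refine exact_of_strand bE.deg (faceDegree bE (rk φ + 0 + 1))
      (faceDegree bE (rk φ + 0 + 1 + 1)) _ _
      (faceSplice (faceForm k (rk φ) (sBasis bE bG φ)))
      (faceD (contractTop k (rk φ) (sBasis bE bG φ) 0)) ?_ ?_ ?_ ?_ ?_
    · exact extend_injective (by rw [extend_faceD, extend_zero, map_zero, extend_zero])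
    · exact fun a x => strand_taylorTwo bE bG φ a x
    · exact fun a x => strand_taylorHigher bE bG φ 0 a x
    · intro f
      rw [faceSplice_eq, extend_faceD]
      exact splice_koszulD (sum_faceForm_contract _ hV) _
    · intro a f hf h0
      rw [faceSplice_eq] at h0
      obtain ⟨F, hF, hF'⟩ := exists_koszulD_eq_of_splice_faceForm_eq_zero hV (rk_le bE)
        hu.linearIndependent (Finset.univ.filter fun l => bE.deg l ≤ a) (extend f)
        (suppOn_extend fun J hJ => (faceDeg_le_iff bE _ _).1 (hf J hJ)) h0
      refine ⟨fun J => F J.1, fun J hJ => (faceDeg_le_iff bE _ _).2 (hF _ hJ).1, ?_⟩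
      apply extend_injective
      rw [extend_faceD, hF.extend_restrict, hF']
  intro x
  have := h x
  simpa using this

lemma exact_taylorHigher_succ (hφ : IsMultigraded bE bG φ) (hu : HasUniformRank bE bG φ) (p : ℕ) :
    Function.Exact (taylorHigher bE bG φ (p + 1)) (taylorHigher bE bG φ p) := by
  classical
  have hV := finrank_imS hφ hu
  refine exact_of_strand (faceDegree bE (rk φ + p + 1)) (faceDegree bE (rk φ + p + 1 + 1))
    (faceDegree bE (rk φ + p + 1 + 1 + 1)) _ _
    (faceD (contractTop k (rk φ) (sBasis bE bG φ) p))
    (faceD (contractTop k (rk φ) (sBasis bE bG φ) (p + 1))) ?_ ?_ ?_ ?_ ?_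
  · exact extend_injective (by rw [extend_faceD, extend_zero, map_zero, extend_zero])
  · exact fun a x => strand_taylorHigher bE bG φ p a x
  · exact fun a x => strand_taylorHigher bE bG φ (p + 1) a x
  · intro f
    apply extend_injective
    rw [extend_faceD, extend_faceD, extend_zero]
    exact koszulD_koszulD _ _ (contractTop_comm p) _
  · intro a f hf h0
    obtain ⟨F, hF, hF'⟩ := exists_koszulD_contractTop_eq hV (rk_le bE)
      hu.linearIndependent (Finset.univ.filter fun l => bE.deg l ≤ a) p (extend f)
      (suppOn_extend fun J hJ => (faceDeg_le_iff bE _ _).1 (hf J hJ))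
      (by rw [← extend_faceD, h0, extend_zero])
    refine ⟨fun J => F J.1, fun J hJ => (faceDeg_le_iff bE _ _).2 (hF _ hJ).1, ?_⟩
    apply extend_injective
    rw [extend_faceD, hF.extend_restrict, hF']

variable (bE bG φ)

lemma free_and_finite_taylor (i : ℕ) :
    Module.Free (MvPolynomial (Fin n) k) (Taylor bE bG φ i) ∧
      Module.Finite (MvPolynomial (Fin n) k) (Taylor bE bG φ i) := by
  match i with
  | 0 => exact ⟨Module.Free.of_basis bG.basis, bG.finite⟩
  | 1 => exact ⟨Module.Free.of_basis bE.basis, bE.finite⟩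
  | p + 2 =>
    exact ⟨inferInstanceAs (Module.Free _ (HigherTaylor bE bG φ p)),
      inferInstanceAs (Module.Finite _ (HigherTaylor bE bG φ p))⟩

end Resolution

end BRT

/-- If the multigraded morphism `φ` has uniform rank, then the Taylor complex `T_•(φ)` is a complex
of finite free modules with zero homology in all positive degrees, and the augmentation to
`coker φ` makes it a free resolution of `coker φ`. -/
theorem corollary4p7 {k : Type u} [Field k] {n e g : ℕ} {E G : Type u}
    [AddCommGroup E] [Module (MvPolynomial (Fin n) k) E]
    [AddCommGroup G] [Module (MvPolynomial (Fin n) k) G]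
    (bE : BRT.HomogeneousBasis k n e E) (bG : BRT.HomogeneousBasis k n g G)
    (φ : E →ₗ[MvPolynomial (Fin n) k] G)
    (hφ : BRT.IsMultigraded bE bG φ) (hu : BRT.HasUniformRank bE bG φ) :
    (∀ i, Function.Exact (BRT.taylorD bE bG φ (i + 1)) (BRT.taylorD bE bG φ i)) ∧
    Function.Exact (BRT.taylorD bE bG φ 0) (BRT.taylorAug bE bG φ) ∧
    Function.Surjective (BRT.taylorAug bE bG φ) ∧
    (∀ i, Module.Free (MvPolynomial (Fin n) k) (BRT.Taylor bE bG φ i) ∧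
      Module.Finite (MvPolynomial (Fin n) k) (BRT.Taylor bE bG φ i)) := by
  have h₀ : Function.Exact φ (LinearMap.range φ).mkQ := LinearMap.exact_map_mkQ_range φ
  have h₁ := BRT.exact_taylorTwo hφ hu
  have h₂ := BRT.exact_taylorHigher_zero hφ hu
  have h₃ := BRT.exact_taylorHigher_succ hφ hu
  refine ⟨fun i => ?_, h₀, (LinearMap.range φ).mkQ_surjective, BRT.free_and_finite_taylor bE bG φ⟩
  match i with
  | 0 => exact h₁
  | 1 => exact h₂
  | p + 2 => exact h₃ p
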